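/- Let $G=(V+r,E)$ be a finite digraph (parallel edges allowed) with edge costs $c(e)\ge 0$, $c(e)\in\mathbb{Q}$, let $T\subseteq V$ be a set of terminals, and let $f:2^V\to\mathbb{Z}$. An edge $uv$ enters $A\subseteq V$ if $v\in A$ and $u\notin A$; for a finite edge set $J$ (a multiset of edges on $V+r$) let $d_J(A)$ be the number of edges of $J$ that enter $A$. A set $A$ is $f$-positive if $f(A)>0$. Put $k_f=\max_{A\subseteq V}f(A)$ and $f^J(A)=\max\{f(A)-d_J(A),0\}$. The cores of a set family are its inclusion-minimal members. Assume the following. 1. $f$ is positively $T$-intersecting supermodular: $f(A)+f(B)\le f(A\cap B)+f(A\cup B)$ whenever $A\cap B\cap T\neq\emptyset$ and $f(A),f(B)>0$. Moreover every $f$-positive set meets $T$, and $k_f\ge 1$. 2. $G$ is quasi-bipartite: every edge of $G$ has an end that is in $T$ or belongs to no $f$-positive set. 3. $E$ contains an $f$-cover, that is, a set $J\subseteq E$ with $d_J(A)\ge f(A)$ for all $A\subseteq V$; let $\tau_f$ be the minimum of $c(J)=\sum_{e\in J}c(e)$ over all $f$-covers $J\subseteq E$. 4. $f$ is accessible through a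 core oracle: for any finite edge set $L$ on $V+r$ (a list of edges, not necessarily from $E$, parallel edges allowed), the oracle returns the list of the cores of $\{A\subseteq V: f^L(A)=k_{f^L}\}$. Let $\mathcal F=\{A\subseteq V: f(A)=k_f\}$, and for $I\subseteq E$ let $\nu_f(I)$ be the number of cores of the residual family $\mathcal F^I=\{A\in\mathcal F: d_I(A)=0\}$. Lemma. There is a single deterministic oracle algorithm which, given $G$, $c$, $T$ and a set $I\subseteq E$ with $\nu_f(I)\ge 1$, and using a core oracle for $f$, finds in time polynomial in the length of the (binary) encoding of its input, where an oracle call is charged for the length of query and answer, an edge set $S\subseteq E\setminus I$ such that $\nu_f(I\cup S)<\nu_f(I)$ and $$\frac{c(S)}{\nu_f(I)-\nu_f(I\cup S)}\le \frac{2}{k_f}\cdot\frac{\tau_f}{\nu_f(I)}.$$ (In particular, if the oracle can be implemented in polynomial time, then this is a polynomial-time algorithm.) -/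

import Mathlib

/-! ## A machine model with a step count

Programs of a small first-order language run on finite binary trees whose leaves are natural
numbers.  Numbers are measured in binary and every elementary step is charged for the full size of
the data that it reads and writes, an oracle call for the size of query and answer.  Up to a
polynomial this is the running time of an oracle Turing machine. -/

namespace Machine

/-- Data: binary trees with natural numbers at the leaves. -/
inductive Data : Type
  | num (k : ℕ) : Data
  | pair (a b : Data) : Data

namespace Data

/-- The size of a tree; a number counts with its binary length. -/
def size : Data → ℕ
  | num k => k.size + 1
  | pair a b => a.size + b.size + 1

/-- Truth test: everything except the number `0` counts as true. -/
def IsTrue (d : Data) : Prop := d ≠ num 0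

def first : Data → Data
  | pair a _ => a
  | num _ => num 0

def second : Data → Data
  | pair _ b => b
  | num _ => num 0

/-- A binary arithmetic operation applied to a pair of numbers (`0` on any other tree). -/
def arith (op : ℕ → ℕ → ℕ) : Data → Data
  | pair (num a) (num b) => num (op a b)
  | _ => num 0

open Classical in
/-- Equality of the two components of a pair: `1` if they are equal, `0` if not. -/
noncomputable def eqTest : Data → Data
  | pair a b => if a = b then num 1 else num 0
  | num _ => num 0

end Data

/-- Programs.  Each program transforms one tree into another. -/
inductive Prog : Type
  | const (k : ℕ) : Prog
  | skip : Prog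
  | fst : Prog
  | snd : Prog
  | eq : Prog
  | le : Prog
  | add : Prog
  | sub : Prog
  | mul : Prog
  | call : Prog
  | seq (p q : Prog) : Prog
  | both (p q : Prog) : Prog
  | cond (c p q : Prog) : Prog
  | loop (c p : Prog) : Prog

open Data in
/-- The elementary steps: `Step O p x y` says that `p` is an instruction that turns `x` into `y`;
`call` is a call of the oracle `O`. -/
inductive Step (O : Data → Data) : Prog → Data → Data → Prop
  | const (k : ℕ) (x : Data) : Step O (.const k) x (num k)
  | skip (x : Data) : Step O .skip x x
  | fst (x : Data) : Step O .fst x x.first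
  | snd (x : Data) : Step O .snd x x.second
  | eq (x : Data) : Step O .eq x x.eqTest
  | le (x : Data) : Step O .le x (x.arith (fun a b => if a ≤ b then 1 else 0))
  | add (x : Data) : Step O .add x (x.arith (fun a b => a + b))
  | sub (x : Data) : Step O .sub x (x.arith (fun a b => a - b))
  | mul (x : Data) : Step O .mul x (x.arith (fun a b => a * b))
  | call (x : Data) : Step O .call x (O x)

open Data in
/-- `Run O p x y t`: with oracle `O`, program `p` started on `x` halts with result `y` after time
`t`.  `seq p q` runs `p` and then `q` on its result, `both p q` runs both on the same input and
pairs the results, `cond c p q` is a conditional, `loop c p` is "while `c` do `p`". -/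
inductive Run (O : Data → Data) : Prog → Data → Data → ℕ → Prop
  | step {p : Prog} {x y : Data} : Step O p x y → Run O p x y (x.size + y.size)
  | seq {p q : Prog} {x y z : Data} {s t : ℕ} :
      Run O p x y s → Run O q y z t → Run O (.seq p q) x z (s + t + 1)
  | both {p q : Prog} {x y z : Data} {s t : ℕ} :
      Run O p x y s → Run O q x z t → Run O (.both p q) x (pair y z) (s + t + 1)
  | condTrue {c p q : Prog} {x b y : Data} {s t : ℕ} :
      Run O c x b s → b.IsTrue → Run O p x y t → Run O (.cond c p q) x y (s + t + 1)
  | condFalse {c p q : Prog} {x b y : Data} {s t : ℕ} :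
      Run O c x b s → ¬ b.IsTrue → Run O q x y t → Run O (.cond c p q) x y (s + t + 1)
  | loopStop {c p : Prog} {x b : Data} {s : ℕ} :
      Run O c x b s → ¬ b.IsTrue → Run O (.loop c p) x x (s + 1)
  | loopNext {c p : Prog} {x b y z : Data} {s t u : ℕ} :
      Run O c x b s → b.IsTrue → Run O p x y t → Run O (.loop c p) y z u →
        Run O (.loop c p) x z (s + t + u + 1)

/-- Lists as trees. -/
def encList {α : Type} (enc : α → Data) : List α → Data
  | [] => .num 0
  | a :: l => .pair (enc a) (encList enc l)

end Machine

namespace EdgeCover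

open Machine

/-! ## Graphs and set functions

The nodes of a digraph are the elements of `V = Fin n` together with the extra node `r`, which is
`none : Option (Fin n)`.  Set functions are defined on the subsets of `V`. -/

/-- The edge `(u, v)` from `u` to `v` enters (covers) the node set `A`. -/
def Enters {n : ℕ} (e : Option (Fin n) × Option (Fin n)) (A : Finset (Fin n)) : Prop :=
  (∀ a ∈ A, e.1 ≠ some a) ∧ ∃ a ∈ A, e.2 = some a

open Classical in
/-- The number of edges of a list of edges (parallel edges allowed) that enter `A`. -/
noncomputable def listDeg {n : ℕ} (L : List (Option (Fin n) × Option (Fin n)))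
    (A : Finset (Fin n)) : ℕ :=
  L.countP (fun e => decide (Enters e A))

/-- The maximum value of a set function. -/
def maxVal {n : ℕ} (f : Finset (Fin n) → ℤ) : ℤ :=
  Finset.univ.sup' ⟨∅, Finset.mem_univ _⟩ f

/-- The family of all sets on which `f` attains its maximum. -/
def topFamily {n : ℕ} (f : Finset (Fin n) → ℤ) : Finset (Finset (Fin n)) :=
  Finset.univ.filter (fun A => f A = maxVal f)

open Classical in
/-- The cores of a family: its inclusion-minimal members. -/
noncomputable def cores {n : ℕ} (F : Finset (Finset (Fin n))) : Finset (Finset (Fin n)) :=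
  F.filter (fun A => Minimal (fun B => B ∈ F) A)

/-- The residual function of `f` with respect to a list of edges. -/
noncomputable def residual {n : ℕ} (f : Finset (Fin n) → ℤ)
    (L : List (Option (Fin n) × Option (Fin n))) (A : Finset (Fin n)) : ℤ :=
  max (f A - (listDeg L A : ℤ)) 0

/-- `f` is positively `T`-intersecting supermodular. -/
def PosIntersectingSupermodular {n : ℕ} (T : Finset (Fin n)) (f : Finset (Fin n) → ℤ) : Prop :=
  ∀ A B : Finset (Fin n), (A ∩ B ∩ T).Nonempty → 0 < f A → 0 < f B →
    f A + f B ≤ f (A ∩ B) + f (A ∪ B)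

/-- A digraph on `V + r` with `m` edges (parallel edges allowed), nonnegative rational edge costs
and a set `T` of terminals. -/
structure Network where
  n : ℕ
  m : ℕ
  edge : Fin m → Option (Fin n) × Option (Fin n)
  cost : Fin m → ℚ≥0
  T : Finset (Fin n)

namespace Network

variable (G : Network)

open Classical in
/-- The number of edges in the edge set `J` that enter `A`. -/
noncomputable def deg (J : Finset (Fin G.m)) (A : Finset (Fin G.n)) : ℕ :=
  (J.filter (fun e => Enters (G.edge e) A)).card

/-- `J` covers the set function `f`. -/
def Covers (f : Finset (Fin G.n) → ℤ) (J : Finset (Fin G.m)) : Prop :=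
  ∀ A : Finset (Fin G.n), f A ≤ (G.deg J A : ℤ)

/-- The cost of an edge set. -/
def totalCost (J : Finset (Fin G.m)) : ℚ≥0 := ∑ e ∈ J, G.cost e

/-- `τ` is the minimum cost of an `f`-cover. -/
def IsOptimalValue (f : Finset (Fin G.n) → ℤ) (τ : ℚ≥0) : Prop :=
  IsLeast {x | ∃ J : Finset (Fin G.m), G.Covers f J ∧ G.totalCost J = x} τ

/-- The end `x` of an edge is a terminal or belongs to no `f`-positive set. -/
def GoodEnd (f : Finset (Fin G.n) → ℤ) (x : Option (Fin G.n)) : Prop :=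
  (∃ t ∈ G.T, x = some t) ∨ ∀ A : Finset (Fin G.n), 0 < f A → ∀ a ∈ A, x ≠ some a

/-- Every edge has an end that is a terminal or belongs to no `f`-positive set. -/
def QuasiBipartite (f : Finset (Fin G.n) → ℤ) : Prop :=
  ∀ e : Fin G.m, G.GoodEnd f (G.edge e).1 ∨ G.GoodEnd f (G.edge e).2

/-- The residual family of `F`: the members of `F` that are not covered by `I`. -/
noncomputable def residualFamily (F : Finset (Finset (Fin G.n))) (I : Finset (Fin G.m)) :
    Finset (Finset (Fin G.n)) :=
  F.filter (fun A => G.deg I A = 0)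

/-- The number of cores of the residual family of `{A | f A = k_f}`. -/
noncomputable def nu (f : Finset (Fin G.n) → ℤ) (I : Finset (Fin G.m)) : ℕ :=
  (cores (G.residualFamily (topFamily f) I)).card

end Network

/-! ## Encodings -/

/-- The root is encoded by `0`, the node `v` of `V` by `v + 1`. -/
def encNode {n : ℕ} : Option (Fin n) → Data
  | none => .num 0
  | some v => .num (v.val + 1)

/-- An edge is encoded by the pair of its tail and its head. -/
def encEdge {n : ℕ} (e : Option (Fin n) × Option (Fin n)) : Data :=
  .pair (encNode e.1) (encNode e.2)

/-- A node set is encoded by the increasing list of its elements. -/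
def encSet {n : ℕ} (A : Finset (Fin n)) : Data :=
  encList (fun v => encNode (some v)) (A.sort (· ≤ ·))

/-- A set of edges of a network is encoded by the increasing list of the indices of its edges. -/
def encIndices {m : ℕ} (J : Finset (Fin m)) : Data :=
  encList (fun e => .num e.val) (J.sort (· ≤ ·))

/-- A cost is encoded by its numerator and its denominator. -/
def encCost (c : ℚ≥0) : Data := .pair (.num c.num) (.num c.den)

/-- The list of the nodes in `V`, the list of the edges with their costs, and the terminals. -/
def encNetwork (G : Network) : Data :=
  .pair (encSet (Finset.univ : Finset (Fin G.n)))
    (.pair (encList (fun e => .pair (encEdge (G.edge e)) (encCost (G.cost e))) (List.finRange G.m))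
      (encSet G.T))

/-- The input of the algorithm: the network and the given edge set. -/
def encInput (G : Network) (I : Finset (Fin G.m)) : Data :=
  .pair (encNetwork G) (encIndices I)

/-- `O` is a core oracle for `f`: asked for any finite list `L` of edges on `V + r` (new edges and
parallel edges allowed), it answers with a list, in some order and without repetition, of the cores
of the family of sets on which the residual function of `f` with respect to `L` is maximum. -/
def IsCoreOracle {n : ℕ} (f : Finset (Fin n) → ℤ) (O : Data → Data) : Prop :=
  ∀ L : List (Option (Fin n) × Option (Fin n)), ∃ K : List (Finset (Fin n)),
    K.Nodup ∧ (∀ A, A ∈ K ↔ A ∈ cores (topFamily (residual f L))) ∧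
      O (encList encEdge L) = encList encSet K

end EdgeCover

/-!
The sets of maximum value that are not covered by `I` form a family that is closed under
intersection and union of members with a common terminal.  Hence its cores are disjoint on the
terminals, and for every core `C` the members that contain `C` and no other core, the *halo* of
`C`, form a lattice.  A core oracle gives, by one query, the smallest member of the halo that
contains a given node (`Instance.closure_spec`).  Covering a lattice of sets that contain `C` is a
shortest path problem: besides the edges of the graph one may go, at no cost, from any node of the
closure of `x` to `x`, and the edges of a path from outside to `C` cover the halo.  The algorithm
runs such a search from every core (`search_spec`) and obtains two kinds of candidates.

* A path that covers the halo of `C`.  It decreases the number of cores by at least one, since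
  every remaining core contains an old core other than `C` (`Instance.nu_add_one_le`).
* A star: an edge `uv` with paths from `v` to `q ≥ 2` cores.  The node `v` lies in two halos, hence
  it is no terminal, and since the graph is quasi-bipartite, `u` is a terminal or lies in no
  positive set.  An uncovered set that contains one of the `q` cores contains `u`
  (`Instance.tail_mem`), so at most one of the remaining cores contains any of the `q` cores, and
  the number of cores decreases by at least `q - 1 ≥ q / 2` (`Instance.nu_add_card_le`).

Let `λ` be the least ratio of cost to guaranteed decrease over all candidates.  The level sets of
the distances from a core, up to the distance `λ / 2`, lie in its halo.  With weights given by the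
lengths of the level intervals they form a dual solution.  It is feasible: an edge `uv` that is
charged by at most one core satisfies the triangle inequality, and one that is charged by several
cores belongs to a star (`Instance.sum_crossedLevels_le`).  An `f`-cover enters every level set at
least `k_f` times, therefore `k_f * ν * λ / 2 ≤ τ` (`Instance.dual_bound`).

For the running time, `PolyTime` expresses that a function of a context is computed by one program
in polynomial time; it is closed under pairing, case distinction, iteration over lists with
intermediate results of polynomial size (`PolyTime.foldl`), and oracle calls with answers of
polynomial size, so that each part of the algorithm, written as an ordinary function on lists, is
seen to be in polynomial time.  Costs are made integral by multiplication with all denominators.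
-/

/-! ### Typed data and polynomially bounded quantities -/

namespace Machine

open Data

/-- Types whose elements are represented injectively by data. -/
class Enc (α : Type) where
  enc : α → Data
  inj : Function.Injective enc

open Enc

instance : Enc Data := ⟨id, fun _ _ h => h⟩

instance : Enc ℕ := ⟨num, fun _ _ h => by simpa using h⟩

instance : Enc Bool := ⟨fun b => num b.toNat, fun a b h => by
  cases a <;> cases b <;> simp_all⟩

instance {m : ℕ} : Enc (Fin m) := ⟨fun e => num e.val, fun a b h => by
  simpa [Fin.ext_iff] using h⟩

instance {n : ℕ} : Enc (Option (Fin n)) := ⟨EdgeCover.encNode, fun a b h => by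
  cases a <;> cases b <;> simp_all [EdgeCover.encNode, Fin.ext_iff]⟩

instance {α β : Type} [Enc α] [Enc β] : Enc (α × β) :=
  ⟨fun x => pair (enc x.1) (enc x.2), fun a b h => by
    simp only [Data.pair.injEq] at h
    exact Prod.ext (inj h.1) (inj h.2)⟩

theorem encList_injective {α : Type} {e : α → Data} (he : Function.Injective e) :
    Function.Injective (encList e) := by
  intro l
  induction l with
  | nil => intro l' h; cases l' <;> simp_all [encList]
  | cons a l ih =>
    intro l' h
    cases l' with
    | nil => simp [encList] at h
    | cons b l' =>
      simp only [encList, Data.pair.injEq] at h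
      rw [he h.1, ih h.2]

instance {α : Type} [Enc α] : Enc (List α) := ⟨encList enc, encList_injective inj⟩

theorem encList_map {α β : Type} (e : β → Data) (f : α → β) (l : List α) :
    encList e (l.map f) = encList (fun a => e (f a)) l := by
  induction l with
  | nil => rfl
  | cons a l ih => simp [encList, ih]

section Enc

variable {α β : Type} [Enc α] [Enc β]

@[simp] theorem enc_data (x : Data) : enc x = x := rfl
@[simp] theorem enc_nat (k : ℕ) : enc k = num k := rfl
@[simp] theorem enc_bool (b : Bool) : enc b = num b.toNat := rfl
@[simp] theorem enc_fin {m : ℕ} (e : Fin m) : enc e = num e.val := rfl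
@[simp] theorem enc_prod (x : α × β) : enc x = pair (enc x.1) (enc x.2) := rfl
@[simp] theorem enc_nil : enc ([] : List α) = num 0 := rfl
@[simp] theorem enc_cons (a : α) (l : List α) : enc (a :: l) = pair (enc a) (enc l) := rfl

/-- The size of an encoded list. -/
theorem size_enc_list (l : List α) :
    (enc l).size = (l.map fun a => (enc a).size + 1).sum + 1 := by
  induction l with
  | nil => rfl
  | cons a l ih => simp only [enc_cons, Data.size, ih, List.map_cons, List.sum_cons]; ring

theorem length_lt_size (l : List α) : l.length < (enc l).size := by
  induction l with
  | nil => simp [Data.size]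
  | cons a l ih => simp only [enc_cons, Data.size, List.length_cons]; omega

theorem size_enc_mem {l : List α} {a : α} (h : a ∈ l) : (enc a).size < (enc l).size := by
  induction l with
  | nil => simp at h
  | cons b l ih =>
    simp only [enc_cons, Data.size]
    rcases List.mem_cons.1 h with rfl | h
    · omega
    · have := ih h; omega

theorem size_enc_list_le {l : List α} {N M : ℕ} (hl : l.length ≤ N)
    (hM : ∀ a ∈ l, (enc a).size ≤ M) : (enc l).size ≤ N * (M + 1) + 1 := by
  rw [size_enc_list]
  have := List.sum_le_card_nsmul (l.map fun a => (enc a).size + 1) (M + 1) (by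
    intro x hx
    obtain ⟨a, ha, rfl⟩ := List.mem_map.1 hx
    exact Nat.succ_le_succ (hM a ha))
  simp only [List.length_map, smul_eq_mul] at this
  have h2 := Nat.mul_le_mul_right (M + 1) hl
  omega

theorem size_enc_append (l l' : List α) :
    (enc (l ++ l')).size + 1 = (enc l).size + (enc l').size := by
  induction l with
  | nil => simp [Data.size]; omega
  | cons a l ih => simp only [List.cons_append, enc_cons, Data.size]; omega

theorem size_enc_reverse (l : List α) : (enc l.reverse).size = (enc l).size := by
  simp [size_enc_list]

theorem size_enc_sublist {l l' : List α} (h : l.Sublist l') : (enc l).size ≤ (enc l').size := by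
  induction h with
  | slnil => rfl
  | cons a _ ih => simp only [enc_cons, Data.size]; omega
  | cons_cons a _ ih => simp only [enc_cons, Data.size]; omega

end Enc

theorem one_le_size (x : Data) : 1 ≤ x.size := by cases x <;> simp [Data.size]

theorem nat_size_le (k : ℕ) : k.size ≤ k := Nat.size_le.2 Nat.lt_two_pow_self

theorem nat_size_add (a b : ℕ) : (a + b).size ≤ a.size + b.size + 1 := by
  rw [Nat.size_le]
  have ha := Nat.lt_size_self a
  have hb := Nat.lt_size_self b
  have h1 : 2 ^ a.size ≤ 2 ^ (a.size + b.size) := Nat.pow_le_pow_right (by norm_num) (by omega)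
  have h2 : 2 ^ b.size ≤ 2 ^ (a.size + b.size) := Nat.pow_le_pow_right (by norm_num) (by omega)
  rw [pow_succ]; omega

theorem nat_size_mul (a b : ℕ) : (a * b).size ≤ a.size + b.size := by
  rw [Nat.size_le, pow_add]
  exact Nat.mul_lt_mul'' (Nat.lt_size_self a) (Nat.lt_size_self b)

theorem polynomial_eval_mono (P : Polynomial ℕ) {a b : ℕ} (h : a ≤ b) : P.eval a ≤ P.eval b := by
  rw [Polynomial.eval_eq_sum, Polynomial.eval_eq_sum]
  exact Finset.sum_le_sum fun i _ => Nat.mul_le_mul_left _ (Nat.pow_le_pow_left h i)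

/-- `b` is bounded by a polynomial in `s`. -/
def PolyBdd {κ : Type} (s b : κ → ℕ) : Prop := ∃ P : Polynomial ℕ, ∀ k, b k ≤ P.eval (s k)

namespace PolyBdd

variable {κ : Type} {s b c : κ → ℕ}

theorem self : PolyBdd s s := ⟨Polynomial.X, fun k => by simp⟩

theorem const (c : ℕ) : PolyBdd s fun _ => c := ⟨Polynomial.C c, fun k => by simp⟩

theorem mono (hb : PolyBdd s b) (h : ∀ k, c k ≤ b k) : PolyBdd s c :=
  let ⟨P, hP⟩ := hb; ⟨P, fun k => (h k).trans (hP k)⟩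

theorem add (hb : PolyBdd s b) (hc : PolyBdd s c) : PolyBdd s fun k => b k + c k :=
  let ⟨P, hP⟩ := hb; let ⟨Q, hQ⟩ := hc
  ⟨P + Q, fun k => by simpa using Nat.add_le_add (hP k) (hQ k)⟩

theorem mul (hb : PolyBdd s b) (hc : PolyBdd s c) : PolyBdd s fun k => b k * c k :=
  let ⟨P, hP⟩ := hb; let ⟨Q, hQ⟩ := hc
  ⟨P * Q, fun k => by simpa using Nat.mul_le_mul (hP k) (hQ k)⟩

theorem eval (P : Polynomial ℕ) (hb : PolyBdd s b) : PolyBdd s fun k => P.eval (b k) :=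
  let ⟨Q, hQ⟩ := hb
  ⟨P.comp Q, fun k => by simpa using polynomial_eval_mono P (hQ k)⟩

theorem trans (hb : PolyBdd s b) (hc : PolyBdd b c) : PolyBdd s c :=
  let ⟨P, hP⟩ := hc; (eval P hb).mono hP

end PolyBdd

/-! ### Functions computable in polynomial time -/

/-- The function `g` of a parameter `k`, the context, is computable in polynomial time from the
data `inp k`, with access to the oracle `O k`: one program serves all contexts. -/
def PolyTime {κ : Type} (O : κ → Data → Data) (inp : κ → Data) {α : κ → Type}
    [∀ k, Enc (α k)] (g : ∀ k, α k) : Prop :=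
  ∃ (p : Prog) (P : Polynomial ℕ), ∀ k, ∃ t,
    Run (O k) p (inp k) (enc (g k)) t ∧ t ≤ P.eval (inp k).size

theorem Run.size_le {O : Data → Data} {p : Prog} {x y : Data} {t : ℕ} (h : Run O p x y t) :
    x.size ≤ t ∧ y.size ≤ t := by
  induction h with
  | step _ => omega
  | seq _ _ _ _ => omega
  | both _ _ _ _ => simp only [Data.size]; omega
  | condTrue _ _ _ _ _ => omega
  | condFalse _ _ _ _ _ => omega
  | loopStop _ _ _ => omega
  | loopNext _ _ _ _ _ _ _ => omega

namespace PolyTime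

variable {κ : Type} {O : κ → Data → Data} {inp : κ → Data}
variable {α β γ : κ → Type} [∀ k, Enc (α k)] [∀ k, Enc (β k)] [∀ k, Enc (γ k)]

theorem of_bdd {g : ∀ k, α k} (p : Prog) {b : κ → ℕ} (hb : PolyBdd (fun k => (inp k).size) b)
    (h : ∀ k, ∃ t, Run (O k) p (inp k) (enc (g k)) t ∧ t ≤ b k) : PolyTime O inp g := by
  obtain ⟨P, hP⟩ := hb
  refine ⟨p, P, fun k => ?_⟩
  obtain ⟨t, ht, htb⟩ := h k
  exact ⟨t, ht, htb.trans (hP k)⟩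

theorem size_bdd {g : ∀ k, α k} (h : PolyTime O inp g) :
    PolyBdd (fun k => (inp k).size) fun k => (enc (g k)).size := by
  obtain ⟨p, P, h⟩ := h
  refine ⟨P, fun k => ?_⟩
  obtain ⟨t, ht, htb⟩ := h k
  exact ht.size_le.2.trans htb

/-- Only the encoding of the result matters. -/
theorem congr_enc {g : ∀ k, α k} {g' : ∀ k, β k} (h : PolyTime O inp g)
    (he : ∀ k, enc (g k) = enc (g' k)) : PolyTime O inp g' := by
  obtain ⟨p, P, h⟩ := h
  refine ⟨p, P, fun k => ?_⟩
  rw [← he k]; exact h k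

theorem congr {g g' : ∀ k, α k} (h : PolyTime O inp g) (he : ∀ k, g k = g' k) :
    PolyTime O inp g' := h.congr_enc fun k => by rw [he k]

theorem step_of_bdd {g : ∀ k, α k} (p : Prog)
    (hb : PolyBdd (fun k => (inp k).size) fun k => (enc (g k)).size)
    (h : ∀ k, Step (O k) p (inp k) (enc (g k))) : PolyTime O inp g :=
  of_bdd p (PolyBdd.self.add hb) fun k => ⟨_, .step (h k), le_rfl⟩

theorem const (c : ℕ) : PolyTime O inp fun _ => c :=
  step_of_bdd (.const c) (PolyBdd.const _) fun _ => .const _ _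

theorem id : PolyTime O inp fun k => inp k :=
  step_of_bdd .skip PolyBdd.self fun _ => .skip _

theorem comp {mid : κ → Data} {g : ∀ k, α k} (hm : PolyTime O inp mid) (hg : PolyTime O mid g) :
    PolyTime O inp g := by
  have hmb := hm.size_bdd
  obtain ⟨p, P, hm⟩ := hm
  obtain ⟨q, Q, hg⟩ := hg
  refine of_bdd (.seq p q) (((PolyBdd.eval P PolyBdd.self).add (PolyBdd.eval Q hmb)).add
    (PolyBdd.const 1)) fun k => ?_
  obtain ⟨s, hs, hsb⟩ := hm k
  obtain ⟨t, ht, htb⟩ := hg k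
  exact ⟨_, .seq hs ht, by simp only [enc_data]; omega⟩

theorem pair {x : ∀ k, α k} {y : ∀ k, β k} (hx : PolyTime O inp x) (hy : PolyTime O inp y) :
    PolyTime O inp fun k => (x k, y k) := by
  obtain ⟨p, P, hx⟩ := hx
  obtain ⟨q, Q, hy⟩ := hy
  refine of_bdd (.both p q) (((PolyBdd.eval P PolyBdd.self).add (PolyBdd.eval Q PolyBdd.self)).add
    (PolyBdd.const 1)) fun k => ?_
  obtain ⟨s, hs, hsb⟩ := hx k
  obtain ⟨t, ht, htb⟩ := hy k
  exact ⟨_, .both hs ht, by omega⟩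

theorem data_pair {x : ∀ k, α k} {y : ∀ k, β k} (hx : PolyTime O inp x) (hy : PolyTime O inp y) :
    PolyTime O inp fun k => Data.pair (enc (x k)) (enc (y k)) :=
  (hx.pair hy).congr_enc fun _ => rfl

/-- Change of context. -/
theorem reindex {g : ∀ k, α k} (h : PolyTime O inp g) {κ' : Type} (φ : κ' → κ) :
    PolyTime (fun q => O (φ q)) (fun q => inp (φ q)) fun q => g (φ q) := by
  obtain ⟨p, P, h⟩ := h
  exact ⟨p, P, fun q => h (φ q)⟩

theorem data_first {x y : κ → Data} :
    PolyTime O (fun k => Data.pair (x k) (y k)) x :=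
  step_of_bdd .fst (PolyBdd.self.mono fun k => by simp only [Data.size, enc_data]; omega)
    fun _ => .fst _

theorem data_second {x y : κ → Data} :
    PolyTime O (fun k => Data.pair (x k) (y k)) y :=
  step_of_bdd .snd (PolyBdd.self.mono fun k => by simp only [Data.size, enc_data]; omega)
    fun _ => .snd _

theorem fst {x : ∀ k, α k × β k} (h : PolyTime O inp x) : PolyTime O inp fun k => (x k).1 :=
  comp (h.congr_enc (g' := fun k => Data.pair (enc (x k).1) (enc (x k).2)) fun _ => rfl)
    (data_first.congr_enc fun _ => rfl)

theorem snd {x : ∀ k, α k × β k} (h : PolyTime O inp x) : PolyTime O inp fun k => (x k).2 :=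
  comp (h.congr_enc (g' := fun k => Data.pair (enc (x k).1) (enc (x k).2)) fun _ => rfl)
    (data_second.congr_enc fun _ => rfl)

/-- A value that is computable in a context remains so when the context is extended by a
variable. -/
theorem lift {g : ∀ k, α k} (h : PolyTime O inp g) :
    PolyTime (κ := Σ k, β k) (fun q => O q.1) (fun q => Data.pair (inp q.1) (enc q.2))
      fun q => g q.1 :=
  comp data_first (h.reindex Sigma.fst)

/-- The variable by which a context has been extended. -/
theorem var {x : κ → Data} {g : ∀ k, α k} : PolyTime O (fun k => Data.pair (x k) (enc (g k))) g :=
  data_second.congr_enc fun _ => rfl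

/-- A variable that is hidden by another one. -/
theorem under {x y : κ → Data} {g : ∀ k, α k} (h : PolyTime O x g) :
    PolyTime O (fun k => Data.pair (x k) (y k)) g := comp data_first h

theorem ite {r : κ → Prop} [∀ k, Decidable (r k)] {x y : ∀ k, α k}
    (hp : PolyTime O inp fun k => decide (r k)) (hx : PolyTime O inp x)
    (hy : PolyTime O inp y) : PolyTime O inp fun k => if r k then x k else y k := by
  obtain ⟨c, R, hc⟩ := hp
  obtain ⟨p, P, hx⟩ := hx
  obtain ⟨q, Q, hy⟩ := hy
  refine of_bdd (.cond c p q) ((((PolyBdd.eval R PolyBdd.self).add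
    (PolyBdd.eval P PolyBdd.self)).add (PolyBdd.eval Q PolyBdd.self)).add
    (PolyBdd.const 1)) fun k => ?_
  obtain ⟨u, hu, hub⟩ := hc k
  obtain ⟨s, hs, hsb⟩ := hx k
  obtain ⟨t, ht, htb⟩ := hy k
  by_cases h : r k
  · simp only [h, if_true]
    exact ⟨_, .condTrue hu (by simp [h, Data.IsTrue]) hs, by omega⟩
  · simp only [h, if_false]
    exact ⟨_, .condFalse hu (by simp [h, Data.IsTrue]) ht, by omega⟩

theorem decide_eq {x y : ∀ k, α k} [∀ k, Decidable (x k = y k)] (hx : PolyTime O inp x)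
    (hy : PolyTime O inp y) : PolyTime O inp fun k => decide (x k = y k) := by
  refine comp (hx.data_pair hy) (step_of_bdd .eq ((PolyBdd.const 2).mono fun k => ?_) fun k => ?_)
  · by_cases h : x k = y k <;> simp [h, Data.size]
  · have : (enc (decide (x k = y k))) = (Data.pair (enc (x k)) (enc (y k))).eqTest := by
      by_cases h : x k = y k
      · simp [h, Data.eqTest]
      · simp [h, Data.eqTest, Enc.inj.eq_iff]
    rw [this]; exact .eq _

theorem decide_le {x y : κ → ℕ} (hx : PolyTime O inp x)
    (hy : PolyTime O inp y) : PolyTime O inp fun k => decide (x k ≤ y k) := by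
  refine comp (hx.data_pair hy) (step_of_bdd .le ((PolyBdd.const 2).mono fun k => ?_) fun k => ?_)
  · by_cases h : x k ≤ y k <;> simp [h, Data.size]
  · have : enc (decide (x k ≤ y k)) =
        (Data.pair (enc (x k)) (enc (y k))).arith fun a b => if a ≤ b then 1 else 0 := by
      by_cases h : x k ≤ y k <;> simp [h, Data.arith]
    rw [this]; exact .le _

theorem add {x y : κ → ℕ} (hx : PolyTime O inp x) (hy : PolyTime O inp y) :
    PolyTime O inp fun k => x k + y k :=
  comp (hx.data_pair hy) (step_of_bdd .add (PolyBdd.self.mono fun k => by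
    have := nat_size_add (x k) (y k)
    simp only [Data.size, enc_nat]; omega) fun _ => .add _)

theorem mul {x y : κ → ℕ} (hx : PolyTime O inp x) (hy : PolyTime O inp y) :
    PolyTime O inp fun k => x k * y k :=
  comp (hx.data_pair hy) (step_of_bdd .mul (PolyBdd.self.mono fun k => by
    have := nat_size_mul (x k) (y k)
    simp only [Data.size, enc_nat]; omega) fun _ => .mul _)

theorem sub {x y : κ → ℕ} (hx : PolyTime O inp x) (hy : PolyTime O inp y) :
    PolyTime O inp fun k => x k - y k :=
  comp (hx.data_pair hy) (step_of_bdd .sub (PolyBdd.self.mono fun k => by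
    have := Nat.size_le_size (Nat.sub_le (x k) (y k))
    simp only [Data.size, enc_nat]; omega) fun _ => .sub _)

theorem not {p : κ → Prop} [∀ k, Decidable (p k)] (hp : PolyTime O inp fun k => decide (p k)) :
    PolyTime O inp fun k => decide ¬ p k :=
  ((const 1).sub (hp.congr_enc (g' := fun k => (decide (p k)).toNat) fun _ => rfl)).congr_enc
    fun k => by by_cases h : p k <;> simp [h]

theorem and {p q : κ → Prop} [∀ k, Decidable (p k)] [∀ k, Decidable (q k)]
    (hp : PolyTime O inp fun k => decide (p k)) (hq : PolyTime O inp fun k => decide (q k)) :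
    PolyTime O inp fun k => decide (p k ∧ q k) :=
  ((hp.congr_enc (g' := fun k => (decide (p k)).toNat) fun _ => rfl).mul
    (hq.congr_enc (g' := fun k => (decide (q k)).toNat) fun _ => rfl)).congr_enc
    fun k => by by_cases h : p k <;> by_cases h' : q k <;> simp [h, h']

theorem nil : PolyTime O inp fun k => ([] : List (α k)) := (const 0).congr_enc fun _ => rfl

theorem cons {x : ∀ k, α k} {l : ∀ k, List (α k)} (hx : PolyTime O inp x) (hl : PolyTime O inp l) :
    PolyTime O inp fun k => x k :: l k := (hx.data_pair hl).congr_enc fun _ => rfl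

theorem tail {l : ∀ k, List (α k)} (hl : PolyTime O inp l) :
    PolyTime O inp fun k => (l k).tail := by
  refine comp (hl.congr_enc (g' := fun k => enc (l k)) fun _ => rfl)
    (step_of_bdd .snd (PolyBdd.self.mono fun k => ?_) fun k => ?_)
  · cases l k <;> simp [Data.size]; omega
  · have : enc (l k).tail = (enc (l k)).second := by cases l k <;> rfl
    rw [this]; exact .snd _

/-- The head of a list; the default value has to be the one that the machine returns. -/
theorem headD {l : ∀ k, List (α k)} {d : ∀ k, α k} (hl : PolyTime O inp l)
    (hd : ∀ k, enc (d k) = num 0) : PolyTime O inp fun k => (l k).headD (d k) := by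
  refine comp (hl.congr_enc (g' := fun k => enc (l k)) fun _ => rfl)
    (step_of_bdd .fst (PolyBdd.self.mono fun k => ?_) fun k => ?_)
  · cases l k <;> simp [Data.size, hd]; omega
  · have : enc ((l k).headD (d k)) = (enc (l k)).first := by
      cases l k <;> simp [hd, Data.first]
    rw [this]; exact .fst _

/-- Iteration over a list.  The intermediate results have to be of polynomial size. -/
theorem foldl {l : ∀ k, List (α k)} {init : ∀ k, β k} {g : ∀ k, β k → α k → β k} {b : κ → ℕ}
    (hl : PolyTime O inp l) (hi : PolyTime O inp init)
    (hg : PolyTime (κ := Σ q : (Σ k, α k), β q.1) (fun q => O q.1.1)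
      (fun q => Data.pair (Data.pair (inp q.1.1) (enc q.1.2)) (enc q.2))
      fun q => g q.1.1 q.2 q.1.2)
    (hb : PolyBdd (fun k => (inp k).size) b)
    (hbound : ∀ k l₁, l₁ <+: l k → (enc (l₁.foldl (g k) (init k))).size ≤ b k) :
    PolyTime O inp fun k => (l k).foldl (g k) (init k) := by
  -- The state of the loop consists of the input, the rest of the list and the current result.
  let st : (k : κ) → List (α k) → β k → Data := fun k l s =>
    Data.pair (inp k) (Data.pair (enc l) (enc s))
  have hsize : ∀ k l s, (st k l s).size = (inp k).size + ((enc l).size + (enc s).size + 1) + 1 :=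
    fun _ _ _ => rfl
  have hinit : PolyTime O inp fun k => st k (l k) (init k) :=
    id.data_pair (hl.data_pair hi)
  have htest : PolyTime (κ := Σ k, List (α k) × β k) (fun q => O q.1)
      (fun q => st q.1 q.2.1 q.2.2) fun q => q.2.1 :=
    (comp data_second data_first).congr_enc fun _ => rfl
  have hbody : PolyTime (κ := Σ k, (α k × List (α k)) × β k) (fun q => O q.1)
      (fun q => st q.1 (q.2.1.1 :: q.2.1.2) q.2.2)
      fun q => st q.1 q.2.1.2 (g q.1 q.2.2 q.2.1.1) := by
    have h1 : PolyTime (κ := Σ k, (α k × List (α k)) × β k) (fun q => O q.1)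
      (fun q => st q.1 (q.2.1.1 :: q.2.1.2) q.2.2) fun q => inp q.1 := data_first
    have h2 : PolyTime (κ := Σ k, (α k × List (α k)) × β k) (fun q => O q.1)
      (fun q => st q.1 (q.2.1.1 :: q.2.1.2) q.2.2) fun q => q.2 :=
      data_second.congr_enc fun _ => rfl
    have h3 : PolyTime (κ := Σ k, (α k × List (α k)) × β k) (fun q => O q.1)
      (fun q => st q.1 (q.2.1.1 :: q.2.1.2) q.2.2) fun q => q.2.1 := h2.fst
    exact h1.data_pair (h3.snd.data_pair (comp ((h1.data_pair h3.fst).data_pair h2.snd)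
      (hg.reindex fun q : Σ k, (α k × List (α k)) × β k => ⟨⟨q.1, q.2.1.1⟩, q.2.2⟩)))
  have hres : PolyTime O (fun k => st k [] ((l k).foldl (g k) (init k)))
      fun k => (l k).foldl (g k) (init k) :=
    (comp data_second data_second).congr_enc fun _ => rfl
  obtain ⟨X, hX⟩ := hl.size_bdd
  dsimp only at hX
  have hXb : PolyBdd (fun k => (inp k).size)
      fun k => (inp k).size + (X.eval (inp k).size + b k + 1) + 1 :=
    (PolyBdd.self.add (((PolyBdd.eval X PolyBdd.self).add hb).add (PolyBdd.const 1))).add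
      (PolyBdd.const 1)
  set N : κ → ℕ := fun k => (inp k).size + (X.eval (inp k).size + b k + 1) + 1 with hN
  obtain ⟨pt, Pt, ht⟩ := htest
  obtain ⟨pb, Pb, hbd⟩ := hbody
  have hloop : ∀ k l₂ l₁, l k = l₁ ++ l₂ → ∃ t,
      Run (O k) (.loop pt pb) (st k l₂ (l₁.foldl (g k) (init k)))
        (st k [] ((l k).foldl (g k) (init k))) t ∧
      t ≤ (l₂.length + 1) * (Pt.eval (N k) + Pb.eval (N k) + 1) := by
    intro k l₂
    induction l₂ with
    | nil =>
      intro l₁ h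
      rw [List.append_nil] at h
      obtain ⟨t, hr, htb⟩ := ht ⟨k, [], l₁.foldl (g k) (init k)⟩
      refine ⟨t + 1, ?_, ?_⟩
      · rw [h]; exact .loopStop hr (by simp [Data.IsTrue])
      · have h1 : (st k [] (l₁.foldl (g k) (init k))).size ≤ N k := by
          have := hbound k l₁ (h ▸ List.prefix_rfl)
          have := hX k
          rw [hsize, hN]
          have h0 := one_le_size (enc (l k))
          simp only [enc_nil, Data.size, Nat.size_zero]; omega
        have := polynomial_eval_mono Pt h1
        simp only [List.length_nil, zero_add, one_mul]
        dsimp only at htb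
        omega
    | cons a l₂ ih =>
      intro l₁ h
      obtain ⟨t, hr, htb⟩ := ht ⟨k, a :: l₂, l₁.foldl (g k) (init k)⟩
      obtain ⟨t', hr', htb'⟩ := hbd ⟨k, (a, l₂), l₁.foldl (g k) (init k)⟩
      obtain ⟨t'', hr'', htb''⟩ := ih (l₁ ++ [a]) (by simp [h])
      refine ⟨t + t' + t'' + 1, ?_, ?_⟩
      · refine .loopNext hr (by simp [Data.IsTrue]) hr' ?_
        simpa [List.foldl_append] using hr''
      · have h1 : (st k (a :: l₂) (l₁.foldl (g k) (init k))).size ≤ N k := by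
          have := hbound k l₁ (h ▸ List.prefix_append _ _)
          have := hX k
          rw [hsize, hN]
          have h0 : (enc (a :: l₂)).size ≤ (enc (l k)).size :=
            size_enc_sublist (h ▸ List.sublist_append_right _ _)
          dsimp only; omega
        have := polynomial_eval_mono Pt h1
        have := polynomial_eval_mono Pb h1
        simp only [List.length_cons]
        rw [add_mul, one_mul]
        dsimp only at htb htb'
        omega
  have hmain : PolyTime O (fun k => st k (l k) (init k))
      fun k => st k [] ((l k).foldl (g k) (init k)) := by
    have hNst : PolyBdd (fun k => (st k (l k) (init k)).size) N := by
      refine PolyBdd.trans (b := fun k => (inp k).size) (PolyBdd.self.mono fun k => ?_) hXb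
      rw [hsize]; omega
    refine of_bdd (.loop pt pb) (b := fun k => (N k + 1) *
        (Pt.eval (N k) + Pb.eval (N k) + 1)) ((hNst.add (PolyBdd.const 1)).mul
        (((PolyBdd.eval Pt hNst).add (PolyBdd.eval Pb hNst)).add (PolyBdd.const 1))) fun k => ?_
    obtain ⟨t, hr, htb⟩ := hloop k (l k) [] rfl
    refine ⟨t, hr, htb.trans (Nat.mul_le_mul_right _ ?_)⟩
    have := length_lt_size (l k)
    have := hX k
    rw [hN]; dsimp only; omega
  exact comp hinit (comp hmain hres)

end PolyTime

end Machine

/-! ### List processing in polynomial time -/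

namespace Machine

open Data Enc

theorem nat_size_sum (l : List ℕ) : l.sum.size ≤ (enc l).size := by
  induction l with
  | nil => simp
  | cons a l ih =>
    have := nat_size_add a l.sum
    simp only [List.sum_cons, enc_cons, Data.size, enc_nat]; omega

/-- The first element of a list that is minimal for the preorder `le`, as a list of length at most
one. -/
def pick {α : Type} (le : α → α → Prop) [DecidableRel le] (l : List α) : List α :=
  l.foldl (fun acc x => if ∃ b ∈ acc, le b x then acc else [x]) []

theorem pick_eq {α : Type} (le : α → α → Prop) [DecidableRel le] (l : List α) (hl : l ≠ [])
    (hrefl : ∀ x ∈ l, le x x) (htot : ∀ x ∈ l, ∀ y ∈ l, le x y ∨ le y x)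
    (htr : ∀ x ∈ l, ∀ y ∈ l, ∀ z ∈ l, le x y → le y z → le x z) :
    ∃ b ∈ l, pick le l = [b] ∧ ∀ x ∈ l, le b x := by
  induction l using List.reverseRecOn with
  | nil => exact absurd rfl hl
  | append_singleton l a ih =>
    have hstep : pick le (l ++ [a]) = if ∃ b ∈ pick le l, le b a then pick le l else [a] := by
      rw [pick, List.foldl_append]; rfl
    by_cases hl' : l = []
    · subst hl'
      have h1 := hrefl a (by simp)
      refine ⟨a, by simp, by simp [pick], by simpa using h1⟩
    · obtain ⟨b, hb, hp, hmin⟩ := ih hl' (fun x hx => hrefl x (by simp [hx]))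
        (fun x hx y hy => htot x (by simp [hx]) y (by simp [hy]))
        (fun x hx y hy z hz => htr x (by simp [hx]) y (by simp [hy]) z (by simp [hz]))
      rw [hstep, hp]
      by_cases hba : le b a
      · refine ⟨b, by simp [hb], by simp [hba], fun x hx => ?_⟩
        rcases List.mem_append.1 hx with h | h
        · exact hmin x h
        · rw [List.mem_singleton.1 h]; exact hba
      · refine ⟨a, by simp, by simp [hba], fun x hx => ?_⟩
        rcases List.mem_append.1 hx with h | h
        · exact htr a (by simp) b (by simp [hb]) x hx
            ((htot a (by simp) b (by simp [hb])).resolve_right hba) (hmin x h)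
        · rw [List.mem_singleton.1 h]; exact hrefl a (by simp)

theorem pick_subset {α : Type} (le : α → α → Prop) [DecidableRel le] (l : List α) :
    ∀ x ∈ pick le l, x ∈ l := by
  induction l using List.reverseRecOn with
  | nil => simp [pick]
  | append_singleton l a ih =>
    have hstep : pick le (l ++ [a]) = if ∃ b ∈ pick le l, le b a then pick le l else [a] := by
      rw [pick, List.foldl_append]; rfl
    rw [hstep]
    split_ifs
    · intro x hx; simp [ih x hx]
    · simp

theorem length_pick_le {α : Type} (le : α → α → Prop) [DecidableRel le] (l : List α) :
    (pick le l).length ≤ 1 := by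
  induction l using List.reverseRecOn with
  | nil => simp [pick]
  | append_singleton l a ih =>
    have hstep : pick le (l ++ [a]) = if ∃ b ∈ pick le l, le b a then pick le l else [a] := by
      rw [pick, List.foldl_append]; rfl
    rw [hstep]
    split_ifs
    · exact ih
    · simp

namespace PolyTime

variable {κ : Type} {O : κ → Data → Data} {inp : κ → Data}
variable {α β γ : κ → Type} [∀ k, Enc (α k)] [∀ k, Enc (β k)] [∀ k, Enc (γ k)]

/-- A call of the oracle with an answer of polynomial size. -/
theorem call {L : ∀ k, α k} {ans : ∀ k, β k} (hL : PolyTime O inp L)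
    (h : ∀ k, O k (enc (L k)) = enc (ans k))
    (hb : PolyBdd (fun k => (inp k).size) fun k => (enc (ans k)).size) :
    PolyTime O inp ans := by
  have hLb := hL.size_bdd
  obtain ⟨p, P, hp⟩ := hL
  refine of_bdd (.seq p .call) (((PolyBdd.eval P PolyBdd.self).add (hLb.add hb)).add
    (PolyBdd.const 1)) fun k => ?_
  obtain ⟨t, ht, htb⟩ := hp k
  refine ⟨_, .seq ht (.step (h k ▸ .call _)), ?_⟩
  omega

theorem reverse {l : ∀ k, List (α k)} (hl : PolyTime O inp l) :
    PolyTime O inp fun k => (l k).reverse := by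
  refine (foldl (β := fun k => List (α k)) (init := fun _ => []) (g := fun _ acc a => a :: acc) hl
    nil (var.under.cons var) hl.size_bdd fun k l₁ h => ?_).congr fun k => by simp
  rw [List.foldl_flip_cons_eq_append', List.append_nil, size_enc_reverse]
  exact size_enc_sublist h.sublist

theorem map {l : ∀ k, List (α k)} {f : ∀ k, α k → β k} (hl : PolyTime O inp l)
    (hf : PolyTime (κ := Σ k, α k) (fun q => O q.1) (fun q => Data.pair (inp q.1) (enc q.2))
      fun q => f q.1 q.2) : PolyTime O inp fun k => (l k).map (f k) := by
  have key : ∀ k (l₁ : List (α k)), l₁.foldl (fun acc a => f k a :: acc) [] =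
      (l₁.map (f k)).reverse := by
    intro k l₁
    induction l₁ using List.reverseRecOn <;> simp_all
  obtain ⟨P, hP⟩ := hf.size_bdd
  have hlb := hl.size_bdd
  refine (reverse (foldl (β := fun k => List (β k)) (init := fun _ => [])
    (g := fun k acc a => f k a :: acc) hl nil (hf.lift.cons var)
    ((hlb.mul ((PolyBdd.eval P ((PolyBdd.self.add hlb).add (PolyBdd.const 1))).add
      (PolyBdd.const 1))).add (PolyBdd.const 1)) fun k l₁ h => ?_)).congr fun k => by simp [key]
  rw [key, size_enc_reverse]
  refine size_enc_list_le ?_ fun b hb => ?_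
  · simpa using h.length_le.trans (length_lt_size (l k)).le
  · obtain ⟨a, ha, rfl⟩ := List.mem_map.1 hb
    refine (hP ⟨k, a⟩).trans (polynomial_eval_mono P ?_)
    have := size_enc_mem (h.subset ha)
    simp only [Data.size]; omega

theorem filter {l : ∀ k, List (α k)} {p : ∀ k, α k → Prop} [∀ k a, Decidable (p k a)]
    (hl : PolyTime O inp l)
    (hp : PolyTime (κ := Σ k, α k) (fun q => O q.1) (fun q => Data.pair (inp q.1) (enc q.2))
      fun q => decide (p q.1 q.2)) :
    PolyTime O inp fun k => (l k).filter fun a => decide (p k a) := by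
  have key : ∀ k (l₁ : List (α k)), l₁.foldl (fun acc a => if p k a then a :: acc else acc) [] =
      (l₁.filter fun a => decide (p k a)).reverse := by
    intro k l₁
    induction l₁ using List.reverseRecOn with
    | nil => simp
    | append_singleton l a ih =>
      by_cases h : p k a <;> simp [List.foldl_append, List.filter_append, h, ih]
  refine (reverse (foldl (β := fun k => List (α k)) (init := fun _ => [])
    (g := fun k acc a => if p k a then a :: acc else acc) hl nil
    (ite hp.lift (var.under.cons var) var) hl.size_bdd fun k l₁ h => ?_)).congr
      fun k => by simp [key]
  rw [key, size_enc_reverse]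
  exact size_enc_sublist (List.filter_sublist.trans h.sublist)

theorem append {l l' : ∀ k, List (α k)} (hl : PolyTime O inp l) (hl' : PolyTime O inp l') :
    PolyTime O inp fun k => l k ++ l' k := by
  refine (foldl (β := fun k => List (α k)) (init := l') (g := fun _ acc a => a :: acc) hl.reverse
    hl' (var.under.cons var) (hl.size_bdd.add hl'.size_bdd) fun k l₁ h => ?_).congr
      fun k => by simp
  rw [List.foldl_flip_cons_eq_append']
  have h1 := size_enc_append l₁.reverse (l' k)
  have h2 := size_enc_sublist h.sublist
  rw [size_enc_reverse] at h1 h2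
  omega

theorem flatten {l : ∀ k, List (List (α k))} (hl : PolyTime O inp l) :
    PolyTime O inp fun k => (l k).flatten := by
  have key : ∀ k (l₁ : List (List (α k))), l₁.foldl (fun acc a => acc ++ a) [] = l₁.flatten := by
    intro k l₁
    induction l₁ using List.reverseRecOn <;> simp_all
  have hsize : ∀ k (l₁ : List (List (α k))), (enc l₁.flatten).size ≤ (enc l₁).size := by
    intro k l₁
    induction l₁ with
    | nil => simp
    | cons a l ih =>
      have := size_enc_append a l.flatten
      simp only [List.flatten_cons, enc_cons, Data.size]; omega
  refine (foldl (β := fun k => List (α k)) (init := fun _ => []) (g := fun _ acc a => acc ++ a) hl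
    nil (var.append var.under) hl.size_bdd fun k l₁ h => ?_).congr fun k => key k (l k)
  rw [key]
  exact (hsize k l₁).trans (size_enc_sublist h.sublist)

theorem flatMap {l : ∀ k, List (α k)} {f : ∀ k, α k → List (β k)} (hl : PolyTime O inp l)
    (hf : PolyTime (κ := Σ k, α k) (fun q => O q.1) (fun q => Data.pair (inp q.1) (enc q.2))
      fun q => f q.1 q.2) : PolyTime O inp fun k => (l k).flatMap (f k) :=
  (hl.map hf).flatten.congr fun k => by rw [List.flatMap_def]

theorem length {l : ∀ k, List (α k)} (hl : PolyTime O inp l) :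
    PolyTime O inp fun k => (l k).length := by
  have key : ∀ k (l₁ : List (α k)), l₁.foldl (fun (acc : ℕ) _ => acc + 1) 0 = l₁.length := by
    intro k l₁
    induction l₁ using List.reverseRecOn <;> simp_all
  refine (foldl (β := fun _ => ℕ) (init := fun _ => 0) (g := fun _ acc _ => acc + 1) hl
    (const 0) (var.add (const 1)) hl.size_bdd fun k l₁ h => ?_).congr fun k => key k (l k)
  rw [key]
  have := h.length_le
  have := length_lt_size (l k)
  have := nat_size_le l₁.length
  simp only [enc_nat, Data.size]; omega

theorem sum {l : κ → List ℕ} (hl : PolyTime O inp l) : PolyTime O inp fun k => (l k).sum := by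
  refine (foldl (β := fun _ => ℕ) (init := fun _ => 0) (g := fun _ acc a => acc + a) hl
    (const 0) (var.add var.under) (hl.size_bdd.add (PolyBdd.const 1)) fun k l₁ h => ?_).congr
      fun k => by rw [List.sum_eq_foldl_nat]
  have h1 := nat_size_sum l₁
  have h2 := size_enc_sublist h.sublist
  rw [List.sum_eq_foldl_nat] at h1
  simp only [enc_nat, Data.size]; omega

theorem exists_mem {l : ∀ k, List (α k)} {p : ∀ k, α k → Prop} [∀ k a, Decidable (p k a)]
    [∀ k, Decidable (∃ a ∈ l k, p k a)]
    (hl : PolyTime O inp l)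
    (hp : PolyTime (κ := Σ k, α k) (fun q => O q.1) (fun q => Data.pair (inp q.1) (enc q.2))
      fun q => decide (p q.1 q.2)) :
    PolyTime O inp fun k => decide (∃ a ∈ l k, p k a) := by
  have key : ∀ k (l₁ : List (α k)), l₁.foldl (fun (acc : ℕ) a => if p k a then 1 else acc) 0 =
      (decide (∃ a ∈ l₁, p k a)).toNat := by
    intro k l₁
    induction l₁ using List.reverseRecOn with
    | nil => simp
    | append_singleton l a ih =>
      by_cases h : p k a <;> simp [List.foldl_append, h, ih, or_and_right, exists_or]
  refine (foldl (β := fun _ => ℕ) (init := fun _ => 0) (g := fun k acc a => if p k a then 1 else acc)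
    hl (const 0) (ite hp.lift (const 1) var) (PolyBdd.const 2) fun k l₁ h => ?_).congr_enc
      fun k => by rw [key, enc_nat, enc_bool]; congr
  rw [key]
  by_cases h : ∃ a ∈ l₁, p k a <;> simp [h, Data.size]

theorem decide_mem {x : ∀ k, α k} {l : ∀ k, List (α k)} [∀ k, Decidable (x k ∈ l k)]
    (hx : PolyTime O inp x) (hl : PolyTime O inp l) :
    PolyTime O inp fun k => decide (x k ∈ l k) := by
  classical
  exact (hl.exists_mem (p := fun k a => a = x k) (var.decide_eq hx.lift)).congr fun k => by simp

theorem pick {l : ∀ k, List (α k)} {le : ∀ k, α k → α k → Prop} [∀ k, DecidableRel (le k)]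
    (hl : PolyTime O inp l)
    (hle : PolyTime (κ := Σ q : (Σ k, α k), α q.1) (fun q => O q.1.1)
      (fun q => Data.pair (Data.pair (inp q.1.1) (enc q.1.2)) (enc q.2))
      fun q => decide (le q.1.1 q.2 q.1.2)) :
    PolyTime O inp fun k => Machine.pick (le k) (l k) := by
  have hctx : PolyTime (κ := Σ q : (Σ q : (Σ k, α k), List (α q.1)), α q.1.1)
      (fun q => O q.1.1.1)
      (fun q => Data.pair (Data.pair (Data.pair (inp q.1.1.1) (enc q.1.1.2)) (enc q.1.2))
        (enc q.2)) fun q => decide (le q.1.1.1 q.2 q.1.1.2) :=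
    comp ((id (inp := fun q : Σ k, α k => Data.pair (inp q.1) (enc q.2))
        (O := fun q => O q.1)).lift.lift.data_pair var)
      (hle.reindex fun q : Σ q : (Σ q : (Σ k, α k), List (α q.1)), α q.1.1 => ⟨q.1.1, q.2⟩)
  refine foldl (β := fun k => List (α k)) (init := fun _ => [])
    (g := fun k acc x => if ∃ b ∈ acc, le k b x then acc else [x]) hl nil
    (ite (exists_mem var hctx) var (var.under.cons nil)) (hl.size_bdd.add (hl.size_bdd.add
      (PolyBdd.const 2))) fun k l₁ h => ?_
  have h1 : (enc (Machine.pick (le k) l₁)).size ≤ 1 * ((enc (l k)).size + 1) + 1 :=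
    size_enc_list_le (length_pick_le _ _) fun a ha =>
      (size_enc_mem (h.subset (pick_subset _ _ a ha))).le
  refine h1.trans ?_
  omega

end PolyTime

end Machine

/-! ### Residual functions, top families and cores -/

namespace EdgeCover

open Machine Data Enc

section Families

variable {n : ℕ} {f : Finset (Fin n) → ℤ} {T : Finset (Fin n)}
variable {F : Finset (Finset (Fin n))} {A B C D : Finset (Fin n)}

theorem le_maxVal (f : Finset (Fin n) → ℤ) (A : Finset (Fin n)) : f A ≤ maxVal f :=
  Finset.le_sup' f (Finset.mem_univ A)

theorem maxVal_eq {k : ℤ} (hA : f A = k) (h : ∀ B, f B ≤ k) : maxVal f = k :=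
  le_antisymm (Finset.sup'_le _ _ fun B _ => h B) (hA ▸ le_maxVal f A)

theorem mem_topFamily : A ∈ topFamily f ↔ f A = maxVal f := by simp [topFamily]

theorem mem_cores : C ∈ cores F ↔ C ∈ F ∧ ∀ A ∈ F, A ⊆ C → A = C := by
  classical
  rw [cores, Finset.mem_filter]
  constructor
  · rintro ⟨h, -, h2⟩
    exact ⟨h, fun A hA hAC => hAC.antisymm (h2 hA hAC)⟩
  · rintro ⟨h, h2⟩
    exact ⟨h, h, fun A hA hAC => (h2 A hA hAC).ge⟩

theorem exists_core_subset (hA : A ∈ F) : ∃ C ∈ cores F, C ⊆ A := by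
  obtain ⟨C, hCA, hC⟩ := F.exists_le_minimal hA
  exact ⟨C, mem_cores.2 ⟨hC.1, fun B hB hBC => hBC.antisymm (hC.2 hB hBC)⟩, hCA⟩

/-- In a `T`-intersecting family a core is contained in every member with which it shares a
terminal. -/
theorem core_subset_of_inter (hF : ∀ A ∈ F, ∀ B ∈ F, (A ∩ B ∩ T).Nonempty → A ∩ B ∈ F)
    (hC : C ∈ cores F) (hA : A ∈ F) (h : (A ∩ C ∩ T).Nonempty) : C ⊆ A := by
  have := (mem_cores.1 hC).2 _ (hF A hA C (mem_cores.1 hC).1 h) Finset.inter_subset_right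
  exact Finset.inter_eq_right.1 this

theorem core_eq_of_inter (hF : ∀ A ∈ F, ∀ B ∈ F, (A ∩ B ∩ T).Nonempty → A ∩ B ∈ F)
    (hC : C ∈ cores F) (hD : D ∈ cores F) (h : (C ∩ D ∩ T).Nonempty) : C = D :=
  ((mem_cores.1 hC).2 _ (mem_cores.1 hD).1 (core_subset_of_inter hF hD (mem_cores.1 hC).1 h)).symm

/-- The cores of a `T`-intersecting family are disjoint on the terminals, so there are at most as
many of them as nodes. -/
theorem card_cores_le (hF : ∀ A ∈ F, ∀ B ∈ F, (A ∩ B ∩ T).Nonempty → A ∩ B ∈ F)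
    (hT : ∀ A ∈ F, (A ∩ T).Nonempty) : (cores F).card ≤ n := by
  rcases (cores F).eq_empty_or_nonempty with h0 | ⟨C₀, hC₀⟩
  · simp [h0]
  have : Nonempty (Fin n) := ⟨(hT C₀ (mem_cores.1 hC₀).1).choose⟩
  choose! t ht using fun C (hC : C ∈ cores F) => hT C (mem_cores.1 hC).1
  simpa using Finset.card_le_card_of_injOn (s := cores F) (t := Finset.univ) t (by simp)
    fun C hC D hD h => core_eq_of_inter hF hC hD ⟨t C, by
      have h1 := ht C hC
      have h2 := ht D hD
      rw [← h] at h2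
      simp only [Finset.mem_inter] at h1 h2 ⊢
      exact ⟨⟨h1.1, h2.1⟩, h1.2⟩⟩

theorem enters_inter_union (e : Option (Fin n) × Option (Fin n)) :
    (Enters e (A ∩ B) → Enters e A ∨ Enters e B) ∧ (Enters e (A ∪ B) → Enters e A ∨ Enters e B) ∧
      (Enters e (A ∩ B) → Enters e (A ∪ B) → Enters e A ∧ Enters e B) := by
  simp only [Enters, Finset.mem_inter, Finset.mem_union]
  refine ⟨?_, ?_, ?_⟩
  · rintro ⟨h, a, ⟨ha, hb⟩, h2⟩
    by_cases hA : ∀ a ∈ A, e.1 ≠ some a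
    · exact .inl ⟨hA, a, ha, h2⟩
    · refine .inr ⟨fun b hb' hb2 => hA fun a ha' ha2 => ?_, a, hb, h2⟩
      have : a = b := by rw [ha2] at hb2; simpa using hb2
      exact h b ⟨this ▸ ha', hb'⟩ hb2
  · rintro ⟨h, a, ha | hb, h2⟩
    · exact .inl ⟨fun a ha => h a (.inl ha), a, ha, h2⟩
    · exact .inr ⟨fun a ha => h a (.inr ha), a, hb, h2⟩
  · rintro ⟨-, a, ⟨ha, hb⟩, h2⟩ ⟨h, -⟩
    exact ⟨⟨fun a ha => h a (.inl ha), a, ha, h2⟩, ⟨fun a ha => h a (.inr ha), a, hb, h2⟩⟩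

theorem listDeg_cons (e : Option (Fin n) × Option (Fin n)) (L) [Decidable (Enters e A)] :
    listDeg (e :: L) A = listDeg L A + if Enters e A then 1 else 0 := by
  classical
  simp only [listDeg, List.countP_cons, decide_eq_true_eq]

theorem listDeg_eq_zero {L : List (Option (Fin n) × Option (Fin n))} :
    listDeg L A = 0 ↔ ∀ e ∈ L, ¬ Enters e A := by
  classical
  simp [listDeg, List.countP_eq_zero]

theorem listDeg_submodular (L : List (Option (Fin n) × Option (Fin n)))
    (A B : Finset (Fin n)) :
    listDeg L (A ∩ B) + listDeg L (A ∪ B) ≤ listDeg L A + listDeg L B := by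
  classical
  induction L with
  | nil => simp [listDeg]
  | cons e L ih =>
    simp only [listDeg_cons]
    obtain ⟨h1, h2, h3⟩ := enters_inter_union (A := A) (B := B) e
    split_ifs <;> first | omega | tauto

theorem residual_top (hf : PosIntersectingSupermodular T f)
    {L : List (Option (Fin n) × Option (Fin n))} (hpos : 0 < maxVal (residual f L))
    (hA : A ∈ topFamily (residual f L)) (hB : B ∈ topFamily (residual f L))
    (h : (A ∩ B ∩ T).Nonempty) : A ∩ B ∈ topFamily (residual f L) := by
  rw [mem_topFamily] at *
  have h1 := le_maxVal (residual f L) (A ∩ B)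
  have h2 := le_maxVal (residual f L) (A ∪ B)
  have h3 := listDeg_submodular L A B
  simp only [residual] at hA hB h1 h2 ⊢
  have h4 := hf A B h (by omega) (by omega)
  omega

/-- An answer of a core oracle lists at most `n + 1` sets; if the residual function vanishes, the
only core is the empty set. -/
theorem card_cores_residual_le (hf : PosIntersectingSupermodular T f)
    (hT : ∀ A : Finset (Fin n), 0 < f A → (A ∩ T).Nonempty)
    (L : List (Option (Fin n) × Option (Fin n))) :
    (cores (topFamily (residual f L))).card ≤ n + 1 := by
  by_cases hpos : 0 < maxVal (residual f L)
  · refine (card_cores_le (T := T) (fun A hA B hB h => residual_top hf hpos hA hB h)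
      fun A hA => hT A ?_).trans (Nat.le_succ _)
    rw [mem_topFamily] at hA
    simp only [residual] at hA hpos
    omega
  · have hsub : cores (topFamily (residual f L)) ⊆ {∅} := by
      intro C hC
      have h0 : ∅ ∈ topFamily (residual f L) := by
        rw [mem_topFamily]
        have := le_maxVal (residual f L) ∅
        have h1 : 0 ≤ residual f L ∅ := le_max_right _ _
        omega
      rw [Finset.mem_singleton]
      exact ((mem_cores.1 hC).2 _ h0 (Finset.empty_subset _)).symm
    have := Finset.card_le_card hsub
    rw [Finset.card_singleton] at this
    omega

end Families

/-! ### The algorithm -/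

/-- An edge with its index, its ends and its scaled cost. -/
abbrev Arc (n m : ℕ) : Type := Fin m × (Option (Fin n) × Option (Fin n)) × ℕ

/-- A node with its distance from a core and the edges of a path to the core. -/
abbrev Entry (n m : ℕ) : Type := Option (Fin n) × ℕ × List (Fin m)

/-- A candidate solution: an upper bound on its cost, a lower bound on the decrease of the number
of cores, and its edges. -/
abbrev Cand (m : ℕ) : Type := ℕ × ℕ × List (Fin m)

section Algorithm

variable {n m : ℕ}

/-- A node set as a list. -/
def nodeList (A : Finset (Fin n)) : List (Option (Fin n)) := (A.sort (· ≤ ·)).map some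

/-- The comparison of entries by distance. -/
def EntryLe (x y : Entry n m) : Prop := x.2.1 ≤ y.2.1

instance : DecidableRel (EntryLe (n := n) (m := m)) := fun x y => Nat.decLe x.2.1 y.2.1

/-- The entries that an arc entering the set of settled nodes offers for its tail. -/
def extensions (arcs : List (Arc n m)) (st : List (Entry n m)) : List (Entry n m) :=
  arcs.flatMap fun a => if ∃ s ∈ st, s.1 = a.2.1.1 then [] else
    (st.filter fun s => decide (s.1 = a.2.1.2)).map fun s =>
      (a.2.1.1, s.2.1 + a.2.2, a.1 :: s.2.2)

/-- Processing of a new entry `c`: its distance and path are given to all new nodes of the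
closure of its node.  If the closure is empty, the node lies outside, and the search ends with
`c`, which is put into the second component. -/
def settle (cl : Option (Fin n) → List (Option (Fin n)))
    (S : List (Entry n m) × List (Entry n m)) (c : Entry n m) :
    List (Entry n m) × List (Entry n m) :=
  if cl c.1 = [] then (S.1, [c]) else
    (S.1 ++ ((cl c.1).filter fun y => decide ¬ ∃ s ∈ S.1, s.1 = y).map fun y => (y, c.2), S.2)

/-- One step of the shortest path search. -/
def searchStep (arcs : List (Arc n m)) (cl : Option (Fin n) → List (Option (Fin n)))
    (S : List (Entry n m) × List (Entry n m)) : List (Entry n m) × List (Entry n m) :=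
  if S.2 = [] then (pick EntryLe (extensions arcs S.1)).foldl (settle cl) S else S

/-- The shortest path search from the core `C`, backwards along arcs and along the closure
operator `cl`, which costs nothing; there are as many steps as nodes. -/
def search (arcs : List (Arc n m)) (cl : Option (Fin n) → List (Option (Fin n)))
    (nodes C : List (Option (Fin n))) : List (Entry n m) × List (Entry n m) :=
  nodes.foldl (fun S _ => searchStep arcs cl S) (C.map fun c => (c, 0, []), [])

/-- The candidates that consist of a single path. -/
def singles (runs : List (List (Entry n m) × List (Entry n m))) : List (Cand m) :=
  runs.flatMap fun r => r.2.map fun c => (c.2.1, 1, c.2.2)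

/-- The paths that start in `v`, over all cores. -/
def legs (runs : List (List (Entry n m) × List (Entry n m))) (v : Option (Fin n)) :
    List (Entry n m) :=
  runs.flatMap fun r => r.1.filter fun s => decide (s.1 = v)

/-- The star of an arc and of at least two paths starting in its head. -/
def star (a : Arc n m) (Q : List (Entry n m)) : List (Cand m) :=
  if 2 ≤ Q.length then
    [(a.2.2 + (Q.map fun s => s.2.1).sum, Q.length - 1, a.1 :: Q.flatMap fun s => s.2.2)] else []

/-- The candidate stars: for every arc, the paths from its head are taken up to a threshold. -/
def stars (arcs : List (Arc n m)) (runs : List (List (Entry n m) × List (Entry n m))) :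
    List (Cand m) :=
  arcs.flatMap fun a => (legs runs a.2.1.2).flatMap fun s₀ =>
    star a ((legs runs a.2.1.2).filter fun s => decide (s.2.1 ≤ s₀.2.1))

/-- The comparison of candidates by the ratio of the first to the second component. -/
def CandLe (x y : Cand m) : Prop := x.1 * y.2.1 ≤ y.1 * x.2.1

instance : DecidableRel (CandLe (m := m)) := fun x y => Nat.decLe (x.1 * y.2.1) (y.1 * x.2.1)

end Algorithm

namespace Network

variable (G : Network)

/-- The cost of an edge, multiplied by the denominators of all costs. -/
def scaledCost (e : Fin G.m) : ℕ :=
  ∏ e', if e' = e then (G.cost e').num else (G.cost e').den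

/-- The edges with their indices and scaled costs. -/
def arcs : List (Arc G.n G.m) := (List.finRange G.m).map fun e => (e, G.edge e, G.scaledCost e)

end Network

/-- The data of the problem with a core oracle, and all hypotheses on them. -/
structure Instance where
  G : Network
  f : Finset (Fin G.n) → ℤ
  O : Data → Data
  I : Finset (Fin G.m)
  supermodular : PosIntersectingSupermodular G.T f
  meets : ∀ A : Finset (Fin G.n), 0 < f A → (A ∩ G.T).Nonempty
  pos : 0 < maxVal f
  quasiBipartite : G.QuasiBipartite f
  coverable : ∃ J, G.Covers f J
  oracle : IsCoreOracle f O
  nu_pos : 1 ≤ G.nu f I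

namespace Instance

variable (ι : Instance)

/-- The answer of the oracle to the query `L`. -/
noncomputable def coreList (L : List (Option (Fin ι.G.n) × Option (Fin ι.G.n))) :
    List (Finset (Fin ι.G.n)) := (ι.oracle L).choose

/-- The answer of the oracle with sets as lists of nodes. -/
noncomputable def answer (L : List (Option (Fin ι.G.n) × Option (Fin ι.G.n))) :
    List (List (Option (Fin ι.G.n))) := (ι.coreList L).map nodeList

/-- The nodes other than the root. -/
def nodes : List (Option (Fin ι.G.n)) := nodeList Finset.univ

/-- The edges of `I` as a query. -/
def baseQuery : List (Option (Fin ι.G.n) × Option (Fin ι.G.n)) :=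
  (ι.G.arcs.filter fun a => decide (a.1 ∈ ι.I.sort (· ≤ ·))).map fun a => a.2.1

/-- The cores of the residual family. -/
noncomputable def coreLists : List (List (Option (Fin ι.G.n))) := ι.answer ι.baseQuery

/-- A query that forces, besides the edges of `I`, every set to contain `C` and no terminal of
another core; the first edge forces `x` into every set, and it is the only edge that
enters `C`. -/
noncomputable def closureQuery (C : List (Option (Fin ι.G.n))) (x : Option (Fin ι.G.n)) :
    List (Option (Fin ι.G.n) × Option (Fin ι.G.n)) :=
  (x, C.headD none) :: (ι.baseQuery ++ ((C.flatMap fun c => ι.nodes.map fun w => (c, w)) ++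
    ι.coreLists.flatMap fun D => if D = C then [] else
      (D.filter fun t => decide (t ∈ nodeList ι.G.T)).map fun t => (none, t)))

/-- The smallest set of the halo of the core `C` that contains `x`, and `[]` if there is none. -/
noncomputable def closure (C : List (Option (Fin ι.G.n))) (x : Option (Fin ι.G.n)) :
    List (Option (Fin ι.G.n)) :=
  if (ι.answer (ι.closureQuery C x)).tail = [] ∧ x ∈ (ι.answer (ι.closureQuery C x)).headD [] then
    (ι.answer (ι.closureQuery C x)).headD [] else []

/-- The results of the searches from all cores. -/
noncomputable def runs : List (List (Entry ι.G.n ι.G.m) × List (Entry ι.G.n ι.G.m)) :=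
  ι.coreLists.map fun C => search ι.G.arcs (ι.closure C) ι.nodes C

/-- All candidate solutions. -/
noncomputable def candidates : List (Cand ι.G.m) := singles ι.runs ++ stars ι.G.arcs ι.runs

/-- The indices of the edges of a best candidate that are not in `I`. -/
noncomputable def output : List (Fin ι.G.m) :=
  (ι.G.arcs.map fun a => a.1).filter fun e => decide (¬ e ∈ ι.I.sort (· ≤ ·) ∧
    e ∈ (pick CandLe ι.candidates).flatMap fun c => c.2.2)

theorem oracle_spec (L : List (Option (Fin ι.G.n) × Option (Fin ι.G.n))) :
    (ι.coreList L).Nodup ∧ (∀ A, A ∈ ι.coreList L ↔ A ∈ cores (topFamily (residual ι.f L))) ∧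
      ι.O (enc L) = enc (ι.answer L) := by
  obtain ⟨h1, h2, h3⟩ := (ι.oracle L).choose_spec
  refine ⟨h1, h2, h3.trans ?_⟩
  change _ = encList enc (List.map _ _)
  rw [encList_map]
  congr 1
  funext A
  change _ = encList enc (List.map _ _)
  rw [encList_map]
  rfl

end Instance

end EdgeCover

/-! ### The algorithm runs in polynomial time -/

namespace EdgeCover

open Machine Data Enc

section Generic

variable {κ : Type} {O : κ → Data → Data} {inp : κ → Data} {n m : κ → ℕ}

theorem polyTime_extensions {arcs : ∀ k, List (Arc (n k) (m k))}
    {st : ∀ k, List (Entry (n k) (m k))} (ha : PolyTime O inp arcs) (hs : PolyTime O inp st) :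
    PolyTime O inp fun k => extensions (arcs k) (st k) :=
  ha.flatMap (.ite (hs.lift.exists_mem (.decide_eq (.fst .var) (.under (.fst (.fst (.snd .var))))))
    .nil (.map (.filter hs.lift (.decide_eq (.fst .var) (.under (.snd (.fst (.snd .var))))))
      (.pair (.under (.fst (.fst (.snd .var)))) (.pair (.add (.fst (.snd .var))
        (.under (.snd (.snd .var)))) (.cons (.under (.fst .var)) (.snd (.snd .var)))))))

theorem polyTime_legs {runs : ∀ k, List (List (Entry (n k) (m k)) × List (Entry (n k) (m k)))}
    {v : ∀ k, Option (Fin (n k))} (hr : PolyTime O inp runs) (hv : PolyTime O inp v) :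
    PolyTime O inp fun k => legs (runs k) (v k) :=
  hr.flatMap (.filter (.fst .var) (.decide_eq (.fst .var) hv.lift.lift))

theorem polyTime_singles {runs : ∀ k, List (List (Entry (n k) (m k)) × List (Entry (n k) (m k)))}
    (hr : PolyTime O inp runs) : PolyTime O inp fun k => singles (runs k) :=
  hr.flatMap (.map (.snd .var) (.pair (.fst (.snd .var)) (.pair (.const 1) (.snd (.snd .var)))))

theorem polyTime_star {a : ∀ k, Arc (n k) (m k)} {Q : ∀ k, List (Entry (n k) (m k))}
    (ha : PolyTime O inp a) (hQ : PolyTime O inp Q) :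
    PolyTime O inp fun k => star (a k) (Q k) :=
  .ite (.decide_le (.const 2) hQ.length) (.cons (.pair (.add (.snd (.snd ha))
    (.sum (.map hQ (.fst (.snd .var))))) (.pair (.sub hQ.length (.const 1))
      (.cons (.fst ha) (.flatMap hQ (.snd (.snd .var)))))) .nil) .nil

theorem polyTime_stars {arcs : ∀ k, List (Arc (n k) (m k))}
    {runs : ∀ k, List (List (Entry (n k) (m k)) × List (Entry (n k) (m k)))}
    (ha : PolyTime O inp arcs) (hr : PolyTime O inp runs) :
    PolyTime O inp fun k => stars (arcs k) (runs k) :=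
  ha.flatMap (.flatMap (polyTime_legs hr.lift (.snd (.fst (.snd .var))))
    (polyTime_star (.under .var) (.filter
      (polyTime_legs hr.lift.lift (.snd (.fst (.snd (.under .var)))))
        (.decide_le (.fst (.snd .var)) (.under (.fst (.snd .var)))))))

theorem foldl_of_length_le_one {α β : κ → Type} [∀ k, Enc (α k)] [∀ k, Enc (β k)]
    {l : ∀ k, List (α k)} {init : ∀ k, β k} {g : ∀ k, β k → α k → β k}
    (hlen : ∀ k, (l k).length ≤ 1) (hl : PolyTime O inp l) (hi : PolyTime O inp init)
    (hg : PolyTime (κ := Σ q : (Σ k, α k), β q.1) (fun q => O q.1.1)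
      (fun q => Data.pair (Data.pair (inp q.1.1) (enc q.1.2)) (enc q.2))
      fun q => g q.1.1 q.2 q.1.2) :
    PolyTime O inp fun k => (l k).foldl (g k) (init k) := by
  obtain ⟨P, hP⟩ := hg.size_bdd
  refine hl.foldl hi hg (hi.size_bdd.add (PolyBdd.eval P ((((PolyBdd.self.add hl.size_bdd).add
    (PolyBdd.const 1)).add hi.size_bdd).add (PolyBdd.const 1)))) fun k l₁ h => ?_
  have h1 := h.length_le.trans (hlen k)
  match l₁, h1, h with
  | [], _, _ => simp
  | [a], _, h =>
    have h2 := hP ⟨⟨k, a⟩, init k⟩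
    have h3 := size_enc_mem (h.subset (by simp : a ∈ [a]))
    simp only [Data.size] at h2
    refine h2.trans ((polynomial_eval_mono P ?_).trans (Nat.le_add_left _ _))
    omega

end Generic

section Search

variable {n m : ℕ} {arcs : List (Arc n m)} {cl : Option (Fin n) → List (Option (Fin n))}

theorem mem_extensions {st : List (Entry n m)} {c : Entry n m} :
    c ∈ extensions arcs st ↔ ∃ a ∈ arcs, (∀ s ∈ st, s.1 ≠ a.2.1.1) ∧ ∃ s ∈ st, s.1 = a.2.1.2 ∧
      c = (a.2.1.1, s.2.1 + a.2.2, a.1 :: s.2.2) := by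
  simp only [extensions, List.mem_flatMap]
  refine exists_congr fun a => and_congr_right fun _ => ?_
  split_ifs with h
  · simp only [List.not_mem_nil, false_iff, not_and]
    intro h'
    obtain ⟨s, hs, hsa⟩ := h
    exact absurd hsa (h' s hs)
  · push Not at h
    simp only [List.mem_map, List.mem_filter, decide_eq_true_eq, and_assoc]
    constructor
    · rintro ⟨s, h1, h2, rfl⟩
      exact ⟨h, s, h1, h2, rfl⟩
    · rintro ⟨-, s, h1, h2, rfl⟩
      exact ⟨s, h1, h2, rfl⟩

/-- Every step either changes nothing, or it processes one extension. -/
theorem searchStep_cases (S : List (Entry n m) × List (Entry n m)) :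
    searchStep arcs cl S = S ∨
      ∃ c ∈ extensions arcs S.1, S.2 = [] ∧ searchStep arcs cl S = settle cl S c := by
  unfold searchStep
  split_ifs with h
  · have hlen := length_pick_le EntryLe (extensions arcs S.1)
    have hsub := pick_subset EntryLe (extensions arcs S.1)
    match hp : pick EntryLe (extensions arcs S.1), hlen with
    | [], _ => simp
    | [c], _ =>
      rw [hp] at hsub
      exact .inr ⟨c, hsub c (by simp), h, by simp⟩
  · exact .inl rfl

/-- Bounds for the state of the search after `j` steps, with arcs of cost at most `W`. -/
structure SearchBound (N W c j : ℕ) (S : List (Entry n m) × List (Entry n m)) : Prop where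
  length_fst : S.1.length ≤ c + j * N
  length_snd : S.2.length ≤ 1
  dist : ∀ s ∈ S.1 ++ S.2, s.2.1 ≤ j * W
  path : ∀ s ∈ S.1 ++ S.2, s.2.2.length ≤ j

theorem SearchBound.step {N W c j : ℕ} {S : List (Entry n m) × List (Entry n m)}
    (hcl : ∀ x, (cl x).length ≤ N) (hW : ∀ a ∈ arcs, a.2.2 ≤ W) (h : SearchBound N W c j S) :
    SearchBound N W c (j + 1) (searchStep arcs cl S) := by
  have hmono : SearchBound N W c (j + 1) S :=
    ⟨h.length_fst.trans (by gcongr; omega), h.length_snd,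
      fun s hs => (h.dist s hs).trans (by gcongr; omega), fun s hs => (h.path s hs).trans (by omega)⟩
  rcases searchStep_cases (arcs := arcs) (cl := cl) S with h' | ⟨e, he, h0, h'⟩
  · rwa [h']
  · rw [h']
    obtain ⟨a, ha, -, s, hs, -, rfl⟩ := mem_extensions.1 he
    have hd := h.dist s (List.mem_append_left _ hs)
    have hp := h.path s (List.mem_append_left _ hs)
    have hWa := hW a ha
    have hj : (j + 1) * W = j * W + W := by ring
    have hjN : (j + 1) * N = j * N + N := by ring
    unfold settle
    split_ifs with hc
    · refine ⟨hmono.length_fst, by simp, fun s' hs' => ?_, fun s' hs' => ?_⟩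
      · rcases List.mem_append.1 hs' with h1 | h1
        · exact hmono.dist s' (List.mem_append_left _ h1)
        · rw [List.mem_singleton.1 h1]; dsimp only; omega
      · rcases List.mem_append.1 hs' with h1 | h1
        · exact hmono.path s' (List.mem_append_left _ h1)
        · rw [List.mem_singleton.1 h1]; simp only [List.length_cons]; omega
    · refine ⟨?_, hmono.length_snd, fun s' hs' => ?_, fun s' hs' => ?_⟩
      · simp only [List.length_append, List.length_map]
        have h1 := (List.length_filter_le (fun y => decide ¬ ∃ s ∈ S.1, s.1 = y)
          (cl a.2.1.1)).trans (hcl _)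
        have h2 := h.length_fst
        omega
      · rw [h0, List.append_nil] at hs'
        rcases List.mem_append.1 hs' with h1 | h1
        · exact hmono.dist s' (List.mem_append_left _ h1)
        · obtain ⟨y, -, rfl⟩ := List.mem_map.1 h1
          dsimp only; omega
      · rw [h0, List.append_nil] at hs'
        rcases List.mem_append.1 hs' with h1 | h1
        · exact hmono.path s' (List.mem_append_left _ h1)
        · obtain ⟨y, -, rfl⟩ := List.mem_map.1 h1
          simp only [List.length_cons]; omega

theorem SearchBound.foldl {N W : ℕ} (hcl : ∀ x, (cl x).length ≤ N) (hW : ∀ a ∈ arcs, a.2.2 ≤ W)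
    (C l : List (Option (Fin n))) :
    SearchBound N W C.length l.length (l.foldl (fun S _ => searchStep arcs cl S)
      ((C.map fun c => (c, 0, [])), [])) := by
  induction l using List.reverseRecOn with
  | nil =>
    refine ⟨by simp, by simp, ?_, ?_⟩ <;> simp
  | append_singleton l a ih =>
    rw [List.foldl_append, List.length_append]
    exact ih.step hcl hW

theorem size_enc_node (x : Option (Fin n)) : (enc x).size ≤ n + 2 := by
  cases x with
  | none => simp [enc, encNode, Data.size]
  | some v =>
    have := nat_size_le (v.val + 1)
    have := v.isLt
    simp only [enc, encNode, Data.size]; omega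

theorem size_enc_fin (e : Fin m) : (enc e).size ≤ m + 1 := by
  have := nat_size_le e.val
  simp only [enc_fin, Data.size]; omega

theorem SearchBound.size_le {N W c j : ℕ} {S : List (Entry n m) × List (Entry n m)}
    (h : SearchBound N W c j S) : (enc S).size ≤
      (c + j * N + 2) * (n + (j + W.size) + j * (m + 2) + 10) := by
  have hentry : ∀ s ∈ S.1 ++ S.2, (enc s).size ≤ n + (j + W.size) + j * (m + 2) + 6 := by
    intro s hs
    have h1 := size_enc_node s.1
    have h2 : (s.2.1).size ≤ j + W.size := by
      have := Nat.size_le_size (h.dist s hs)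
      have := nat_size_mul j W
      have := nat_size_le j
      omega
    have h3 := size_enc_list_le (h.path s hs) fun e _ => size_enc_fin e
    have h4 : j * (m + 1 + 1) = j * (m + 2) := by ring
    simp only [enc_prod, enc_nat, Data.size]; omega
  have h1 := size_enc_list_le h.length_fst fun s hs => hentry s (List.mem_append_left _ hs)
  have h2 := size_enc_list_le h.length_snd fun s hs => hentry s (List.mem_append_right _ hs)
  simp only [enc_prod, Data.size]
  generalize n + (j + W.size) + j * (m + 2) = X at *
  nlinarith

end Search

namespace Instance

/-! The context `k` provides an instance `ι k`, whose input is computable from the data of the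
context. -/

variable {κ : Type} {ι : κ → Instance} {inp : κ → Data}

/-- The input of the algorithm. -/
def input (ι : Instance) : Data := encInput ι.G ι.I

/-- The input edges as they are listed in the input. -/
def rawEdges (ι : Instance) : List ((Option (Fin ι.G.n) × Option (Fin ι.G.n)) × (ℕ × ℕ)) :=
  (List.finRange ι.G.m).map fun e => (ι.G.edge e, ((ι.G.cost e).num, (ι.G.cost e).den))

theorem encSet_eq {n : ℕ} (A : Finset (Fin n)) : encSet A = enc (nodeList A) :=
  (encList_map _ _ _).symm

theorem input_eq (ι : Instance) : ι.input =
    enc ((ι.nodes, (ι.rawEdges, nodeList ι.G.T)), ι.I.sort (· ≤ ·)) := by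
  simp only [input, encInput, encNetwork, encSet_eq, enc_prod]
  congr 3
  change _ = encList enc (List.map _ _)
  rw [encList_map]
  rfl

theorem polyTime_tuple (h : PolyTime (fun k => (ι k).O) inp fun k => (ι k).input) :
    PolyTime (fun k => (ι k).O) inp fun k => (((ι k).nodes, ((ι k).rawEdges, nodeList (ι k).G.T)),
      (ι k).I.sort (· ≤ ·)) := h.congr_enc fun k => (ι k).input_eq

theorem polyTime_nodes (h : PolyTime (fun k => (ι k).O) inp fun k => (ι k).input) :
    PolyTime (fun k => (ι k).O) inp fun k => (ι k).nodes :=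
  .fst (.fst (polyTime_tuple h))

theorem polyTime_rawEdges (h : PolyTime (fun k => (ι k).O) inp fun k => (ι k).input) :
    PolyTime (fun k => (ι k).O) inp fun k => (ι k).rawEdges :=
  .fst (.snd (.fst (polyTime_tuple h)))

theorem polyTime_terminals (h : PolyTime (fun k => (ι k).O) inp fun k => (ι k).input) :
    PolyTime (fun k => (ι k).O) inp fun k => nodeList (ι k).G.T :=
  .snd (.snd (.fst (polyTime_tuple h)))

theorem polyTime_indices (h : PolyTime (fun k => (ι k).O) inp fun k => (ι k).input) :
    PolyTime (fun k => (ι k).O) inp fun k => (ι k).I.sort (· ≤ ·) :=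
  .snd (polyTime_tuple h)

theorem length_nodes (ι : Instance) : ι.nodes.length = ι.G.n := by simp [nodes, nodeList]

theorem bdd_n (h : PolyTime (fun k => (ι k).O) inp fun k => (ι k).input) :
    PolyBdd (fun k => (inp k).size) fun k => (ι k).G.n :=
  (polyTime_nodes h).size_bdd.mono fun k => by
    exact (length_nodes (ι k)).symm.le.trans (length_lt_size _).le

theorem bdd_m (h : PolyTime (fun k => (ι k).O) inp fun k => (ι k).input) :
    PolyBdd (fun k => (inp k).size) fun k => (ι k).G.m :=
  (polyTime_rawEdges h).size_bdd.mono fun k => by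
    have := length_lt_size (ι k).rawEdges
    simp only [rawEdges, List.length_map, List.length_finRange] at this
    exact this.le

/-- The input edges together with their indices. -/
def indexedEdges (ι : Instance) :
    List (Fin ι.G.m × ((Option (Fin ι.G.n) × Option (Fin ι.G.n)) × (ℕ × ℕ))) :=
  (List.finRange ι.G.m).map fun e => (e, (ι.G.edge e, ((ι.G.cost e).num, (ι.G.cost e).den)))

theorem foldl_index {α : Type} (l : List α) :
    l.foldl (fun (acc : List (ℕ × α)) x => (acc.length, x) :: acc) [] =
      (l.zipIdx.map Prod.swap).reverse := by
  induction l using List.reverseRecOn with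
  | nil => simp
  | append_singleton l a ih => simp [List.foldl_append, ih, List.zipIdx_append]

theorem polyTime_indexedEdges (h : PolyTime (fun k => (ι k).O) inp fun k => (ι k).input) :
    PolyTime (fun k => (ι k).O) inp fun k => (ι k).indexedEdges := by
  have hr := polyTime_rawEdges h
  have h1 : PolyTime (fun k => (ι k).O) inp fun k => (ι k).rawEdges.foldl
      (fun (acc : List (ℕ × _)) x => (acc.length, x) :: acc) [] := by
    refine hr.foldl .nil (.cons (.pair (.length .var) (.under .var)) .var)
      ((hr.size_bdd.mul ((hr.size_bdd.add hr.size_bdd).add (PolyBdd.const 3))).add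
        (PolyBdd.const 1)) fun k l₁ hl => ?_
    rw [foldl_index, size_enc_reverse]
    have hlen := hl.length_le
    have hlen' := length_lt_size (ι k).rawEdges
    refine size_enc_list_le (by simp; omega) fun x hx => ?_
    obtain ⟨⟨a, i⟩, ha, rfl⟩ := List.mem_map.1 hx
    have h1 := List.snd_lt_of_mem_zipIdx ha
    have h2 := nat_size_le i
    have h3 := size_enc_mem (hl.subset (List.fst_mem_of_mem_zipIdx ha))
    simp only [Prod.swap, enc_nat, Data.size, enc_prod (α := ℕ)] at h3 ⊢
    omega
  refine h1.reverse.congr_enc fun k => ?_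
  rw [foldl_index, List.reverse_reverse]
  have : (ι k).rawEdges.zipIdx.map Prod.swap = (ι k).indexedEdges.map fun x => (x.1.val, x.2) := by
    refine List.ext_getElem (by simp [rawEdges, indexedEdges]) fun i _ _ => ?_
    simp [rawEdges, indexedEdges]
  rw [this]
  change encList enc (List.map _ _) = encList enc _
  rw [encList_map]
  rfl

theorem polyTime_arcs (h : PolyTime (fun k => (ι k).O) inp fun k => (ι k).input) :
    PolyTime (fun k => (ι k).O) inp fun k => (ι k).G.arcs := by
  have hi := polyTime_indexedEdges h
  have key : ∀ k (e : Fin (ι k).G.m) l, (enc (List.foldl (fun (acc : ℕ)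
      (b : Fin (ι k).G.m × ((Option (Fin (ι k).G.n) × Option (Fin (ι k).G.n)) × (ℕ × ℕ))) =>
        acc * if b.1 = e then b.2.2.1 else b.2.2.2) 1 l)).size ≤ (enc l).size + 1 := by
    intro k e l
    induction l using List.reverseRecOn with
    | nil => simp [Data.size]
    | append_singleton l b ih =>
      rw [List.foldl_append]
      have h1 := size_enc_append l [b]
      have h2 := nat_size_mul (List.foldl (fun (acc : ℕ)
        (b : Fin (ι k).G.m × ((Option (Fin (ι k).G.n) × Option (Fin (ι k).G.n)) × (ℕ × ℕ))) =>
          acc * if b.1 = e then b.2.2.1 else b.2.2.2) 1 l) (if b.1 = e then b.2.2.1 else b.2.2.2)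
      have h3 : (if b.1 = e then b.2.2.1 else b.2.2.2).size + 1 ≤ (enc b).size := by
        simp only [enc_prod, enc_nat, Data.size]
        split_ifs <;> omega
      simp only [enc_nat, enc_nil, enc_cons, Data.size, List.foldl_cons, List.foldl_nil] at *
      omega
  refine (hi.map (f := fun k a => (a.1, a.2.1, (ι k).indexedEdges.foldl
    (fun (acc : ℕ) b => acc * if b.1 = a.1 then b.2.2.1 else b.2.2.2) 1))
    (.pair (.fst .var) (.pair (.fst (.snd .var)) (.foldl hi.lift (.const 1)
      (.mul .var (.ite (.decide_eq (.fst (.under .var)) (.fst (.under (.under .var))))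
        (.fst (.snd (.snd (.under .var)))) (.snd (.snd (.snd (.under .var))))))
      (hi.lift.size_bdd.add (PolyBdd.const 1)) fun q l₁ hl => ?_)))).congr fun k => ?_
  · refine (key q.1 q.2.1 l₁).trans ?_
    have := size_enc_sublist hl.sublist
    omega
  · simp only [indexedEdges, Network.arcs, List.map_map]
    refine List.map_congr_left fun e _ => ?_
    simp only [Function.comp, Prod.mk.injEq, true_and, Network.scaledCost, List.foldl_map]
    rw [Fin.prod_univ_def, List.prod_eq_foldl, List.foldl_map]

theorem length_nodeList_le {n : ℕ} (A : Finset (Fin n)) : (nodeList A).length ≤ n := by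
  simpa [nodeList] using Finset.card_le_univ A

theorem length_answer_le (ι : Instance) (L) : (ι.answer L).length ≤ ι.G.n + 1 := by
  classical
  obtain ⟨h1, h2, -⟩ := ι.oracle_spec L
  rw [answer, List.length_map, ← List.toFinset_card_of_nodup h1]
  refine (Finset.card_le_card fun A hA => ?_).trans
    (card_cores_residual_le ι.supermodular ι.meets L)
  rw [← h2]
  exact List.mem_toFinset.1 hA

theorem mem_answer {ι : Instance} {L A} (h : A ∈ ι.answer L) :
    ∃ B ∈ cores (topFamily (residual ι.f L)), nodeList B = A := by
  obtain ⟨B, hB, rfl⟩ := List.mem_map.1 h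
  exact ⟨B, ((ι.oracle_spec L).2.1 B).1 hB, rfl⟩

theorem polyTime_answer (h : PolyTime (fun k => (ι k).O) inp fun k => (ι k).input)
    {L : ∀ k, List (Option (Fin (ι k).G.n) × Option (Fin (ι k).G.n))}
    (hL : PolyTime (fun k => (ι k).O) inp L) :
    PolyTime (fun k => (ι k).O) inp fun k => (ι k).answer (L k) := by
  have hn := bdd_n h
  refine hL.call (fun k => ((ι k).oracle_spec (L k)).2.2) (PolyBdd.mono (((hn.add
    (PolyBdd.const 1)).mul (((hn.mul ((hn.add (PolyBdd.const 2)).add (PolyBdd.const 1))).add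
      (PolyBdd.const 1)).add (PolyBdd.const 1))).add (PolyBdd.const 1)) fun k => ?_)
  refine size_enc_list_le (length_answer_le _ _) fun A hA => ?_
  obtain ⟨B, -, rfl⟩ := mem_answer hA
  exact size_enc_list_le (length_nodeList_le B) fun x _ => size_enc_node x

theorem polyTime_baseQuery (h : PolyTime (fun k => (ι k).O) inp fun k => (ι k).input) :
    PolyTime (fun k => (ι k).O) inp fun k => (ι k).baseQuery :=
  .map (.filter (polyTime_arcs h) (.decide_mem (.fst .var) (polyTime_indices h).lift))
    (.fst (.snd .var))

theorem polyTime_coreLists (h : PolyTime (fun k => (ι k).O) inp fun k => (ι k).input) :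
    PolyTime (fun k => (ι k).O) inp fun k => (ι k).coreLists :=
  polyTime_answer h (polyTime_baseQuery h)

theorem polyTime_closure (h : PolyTime (fun k => (ι k).O) inp fun k => (ι k).input)
    {C : ∀ k, List (Option (Fin (ι k).G.n))} {x : ∀ k, Option (Fin (ι k).G.n)}
    (hC : PolyTime (fun k => (ι k).O) inp C) (hx : PolyTime (fun k => (ι k).O) inp x) :
    PolyTime (fun k => (ι k).O) inp fun k => (ι k).closure (C k) (x k) := by
  have hq : PolyTime (fun k => (ι k).O) inp fun k => (ι k).closureQuery (C k) (x k) :=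
    .cons (.pair hx (.headD hC fun _ => rfl)) (.append (polyTime_baseQuery h) (.append
      (.flatMap hC (.map (polyTime_nodes h).lift (.pair (.under .var) .var)))
      (.flatMap (polyTime_coreLists h) (.ite (.decide_eq .var hC.lift) .nil (.map
        (.filter .var (.decide_mem .var (polyTime_terminals h).lift.lift))
        (.pair (.congr_enc (.const 0) fun _ => rfl) .var))))))
  have ha := polyTime_answer h hq
  exact .ite (.and (.decide_eq ha.tail .nil) (.decide_mem hx (.headD ha fun _ => rfl)))
    (.headD ha fun _ => rfl) .nil

theorem length_closure_le (ι : Instance) (C x) : (ι.closure C x).length ≤ ι.G.n := by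
  unfold closure
  split_ifs with h
  · cases ha : ι.answer (ι.closureQuery C x) with
    | nil => simp
    | cons A l =>
      obtain ⟨B, -, hB⟩ := mem_answer (ha ▸ List.mem_cons_self : A ∈ ι.answer _)
      simpa [← hB] using length_nodeList_le B
  · simp

theorem polyTime_search (h : PolyTime (fun k => (ι k).O) inp fun k => (ι k).input)
    {C : ∀ k, List (Option (Fin (ι k).G.n))} (hC : PolyTime (fun k => (ι k).O) inp C) :
    PolyTime (fun k => (ι k).O) inp fun k =>
      search (ι k).G.arcs ((ι k).closure (C k)) (ι k).nodes (C k) := by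
  have ha := polyTime_arcs h
  have hn := bdd_n h
  have hm := bdd_m h
  refine .foldl (polyTime_nodes h) (.pair (.map hC (.pair .var (.pair (.const 0) .nil))) .nil)
    (.ite (.decide_eq (.snd .var) .nil) (foldl_of_length_le_one (fun _ => length_pick_le _ _)
      (.pick (polyTime_extensions ha.lift.lift (.fst .var))
        (.decide_le (.fst (.snd .var)) (.fst (.snd (.under .var))))) .var ?_) .var)
    (b := fun k => ((enc (C k)).size + (ι k).G.n * (ι k).G.n + 2) * ((ι k).G.n +
      ((ι k).G.n + (enc (ι k).G.arcs).size) + (ι k).G.n * ((ι k).G.m + 2) + 10)) ?_ ?_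
  · exact .ite (.decide_eq (polyTime_closure h.lift.lift.lift.lift hC.lift.lift.lift.lift
      (.fst (.under .var))) .nil) (.pair (.fst .var) (.cons (.under .var) .nil))
      (.pair (.append (.fst .var) (.map (.filter (polyTime_closure
        h.lift.lift.lift.lift hC.lift.lift.lift.lift (.fst (.under .var)))
        (.not (.exists_mem (.fst (.under .var))
        (.decide_eq (.fst .var) (.under .var))))) (.pair .var (.snd (.under (.under .var))))))
        (.snd .var))
  · exact ((hC.size_bdd.add (hn.mul hn)).add (PolyBdd.const 2)).mul
      (((hn.add (hn.add ha.size_bdd)).add (hn.mul (hm.add (PolyBdd.const 2)))).add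
        (PolyBdd.const 10))
  · intro k l₁ hl
    have h1 := (SearchBound.foldl (arcs := (ι k).G.arcs) (W := ((ι k).G.arcs.map fun a => a.2.2).sum)
      (length_closure_le (ι k) (C k)) (fun a ha => List.le_sum_of_mem
        (List.mem_map.2 ⟨a, ha, rfl⟩)) (C k) l₁).size_le
    have h2 : ((ι k).G.arcs.map fun a : Arc _ _ => a.2.2).sum.size ≤ (enc (ι k).G.arcs).size := by
      refine (nat_size_sum _).trans ?_
      rw [size_enc_list, size_enc_list, List.map_map]
      refine Nat.succ_le_succ (List.sum_le_sum fun a _ => ?_)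
      simp only [Function.comp, enc_prod, Data.size]; omega
    have h3 := hl.length_le
    rw [length_nodes] at h3
    have h4 := (length_lt_size (C k)).le
    refine h1.trans ?_
    gcongr

theorem polyTime_output (h : PolyTime (fun k => (ι k).O) inp fun k => (ι k).input) :
    PolyTime (fun k => (ι k).O) inp fun k => (ι k).output := by
  have hr : PolyTime (fun k => (ι k).O) inp fun k => (ι k).runs :=
    .map (polyTime_coreLists h) (polyTime_search h.lift .var)
  have hc : PolyTime (fun k => (ι k).O) inp fun k => (ι k).candidates :=
    .append (polyTime_singles hr) (polyTime_stars (polyTime_arcs h) hr)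
  have hp : PolyTime (fun k => (ι k).O) inp fun k => pick CandLe (ι k).candidates :=
    .pick hc (.decide_le (.mul (.fst .var) (.fst (.snd (.under .var))))
      (.mul (.fst (.under .var)) (.fst (.snd .var))))
  have he : PolyTime (fun k => (ι k).O) inp fun k =>
      (pick CandLe (ι k).candidates).flatMap fun c => c.2.2 := .flatMap hp (.snd (.snd .var))
  exact .filter (.map (polyTime_arcs h) (.fst .var)) (.and (.not (.decide_mem .var
    (polyTime_indices h).lift)) (.decide_mem .var he.lift))

end Instance

/-- One program computes the output of the algorithm for all instances in polynomial time. -/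
theorem exists_prog : ∃ (p : Prog) (P : Polynomial ℕ), ∀ ι : Instance, ∃ t,
    Run ι.O p (encInput ι.G ι.I) (enc ι.output) t ∧ t ≤ P.eval (encInput ι.G ι.I).size :=
  Instance.polyTime_output (ι := fun ι => ι) (inp := fun ι => ι.input) .id

end EdgeCover

/-! ### Correctness of the shortest path search -/

namespace EdgeCover

open Machine Data Enc

section NodeList

variable {n : ℕ} {A B : Finset (Fin n)}

theorem mem_nodeList {x : Option (Fin n)} : x ∈ nodeList A ↔ ∃ v ∈ A, some v = x := by
  simp [nodeList]

@[simp] theorem some_mem_nodeList {v : Fin n} : some v ∈ nodeList A ↔ v ∈ A := by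
  simp [nodeList]

@[simp] theorem none_notMem_nodeList : none ∉ nodeList A := by simp [nodeList]

theorem nodeList_subset : (∀ x ∈ nodeList A, x ∈ nodeList B) ↔ A ⊆ B := by
  constructor
  · intro h v hv
    simpa using h (some v) (by simpa using hv)
  · intro h x hx
    obtain ⟨v, hv, rfl⟩ := mem_nodeList.1 hx
    simpa using h hv

theorem nodeList_injective : Function.Injective (nodeList (n := n)) := fun _ _ h =>
  (nodeList_subset.1 fun _ hx => h ▸ hx).antisymm (nodeList_subset.1 fun _ hx => h ▸ hx)

theorem nodup_nodeList (A : Finset (Fin n)) : (nodeList A).Nodup :=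
  (A.sort_nodup _).map (Option.some_injective _)

theorem enters_iff {e : Option (Fin n) × Option (Fin n)} :
    Enters e A ↔ e.1 ∉ nodeList A ∧ e.2 ∈ nodeList A := by
  simp only [Enters, mem_nodeList]
  refine and_congr ⟨?_, ?_⟩ ⟨?_, ?_⟩
  · rintro h ⟨a, ha, h2⟩; exact h a ha h2.symm
  · intro h a ha h2; exact h ⟨a, ha, h2.symm⟩
  · rintro ⟨a, ha, h⟩; exact ⟨a, ha, h.symm⟩
  · rintro ⟨a, ha, h⟩; exact ⟨a, ha, h.symm⟩

end NodeList

/-- The hypotheses of the search: `H` is a union-closed family of sets containing `C`, every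
member is entered by an edge, and `cl x` lists the smallest member that contains `x`. -/
structure SearchSpace {n m : ℕ} (edge : Fin m → Option (Fin n) × Option (Fin n))
    (H : Finset (Fin n) → Prop) (C : Finset (Fin n))
    (cl : Option (Fin n) → List (Option (Fin n))) : Prop where
  core : H C
  core_nonempty : C.Nonempty
  union : ∀ A B, H A → H B → H (A ∪ B)
  core_subset : ∀ A, H A → C ⊆ A
  covered : ∀ A, H A → ∃ e, Enters (edge e) A
  closure : ∀ x, x ∉ nodeList C → (cl x = [] ∧ ∀ A, H A → x ∉ nodeList A) ∨
    ∃ B, cl x = nodeList B ∧ H B ∧ x ∈ nodeList B ∧ ∀ A, H A → x ∈ nodeList A → B ⊆ A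

section Search

variable {n m : ℕ} (edge : Fin m → Option (Fin n) × Option (Fin n)) (cost : Fin m → ℕ)
  (H : Finset (Fin n) → Prop)

/-- The invariant of the settled entries. -/
structure Settled (st : List (Entry n m)) : Prop where
  nodup : (st.map Prod.fst).Nodup
  level : ∀ θ, 0 < θ → ∃ B, H B ∧ ∀ x, x ∈ nodeList B ↔ ∃ s ∈ st, s.1 = x ∧ s.2.1 < θ
  triangle : ∀ e, ∀ s ∈ st, s.1 = (edge e).2 → ∀ s' ∈ st, s'.1 = (edge e).1 →
    s'.2.1 ≤ s.2.1 + cost e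
  frontier : ∀ e, ∀ s ∈ st, s.1 = (edge e).2 → (∀ s' ∈ st, s'.1 ≠ (edge e).1) →
    ∀ s' ∈ st, s'.2.1 ≤ s.2.1 + cost e
  path_cost : ∀ s ∈ st, (s.2.2.map cost).sum = s.2.1
  path_tail : ∀ s ∈ st, ∀ e ∈ s.2.2, ∃ s' ∈ st, s'.1 = (edge e).1
  path_cover : ∀ s ∈ st, ∀ A, H A → s.1 ∉ nodeList A → ∃ e ∈ s.2.2, Enters (edge e) A

/-- The properties of the entry `c` with which the search ends. -/
structure Finished (st : List (Entry n m)) (c : Entry n m) : Prop where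
  frontier : ∀ e, ∀ s ∈ st, s.1 = (edge e).2 → (∀ s' ∈ st, s'.1 ≠ (edge e).1) →
    c.2.1 ≤ s.2.1 + cost e
  path_cost : (c.2.2.map cost).sum = c.2.1
  path_cover : ∀ A, H A → ∃ e ∈ c.2.2, Enters (edge e) A

variable {edge cost H} {C : Finset (Fin n)} {cl : Option (Fin n) → List (Option (Fin n))}

theorem settled_init (hS : SearchSpace edge H C cl) :
    Settled edge cost H ((nodeList C).map fun c => ((c, 0, []) : Entry n m)) where
  nodup := by
    rw [List.map_map]
    exact (nodup_nodeList C).map fun _ _ h => h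
  level θ hθ := ⟨C, hS.core, fun x => by simp [hθ]⟩
  triangle := by
    intro e s hs _ s' hs' _
    obtain ⟨_, _, rfl⟩ := List.mem_map.1 hs'
    simp
  frontier := by
    intro e s hs _ _ s' hs'
    obtain ⟨_, _, rfl⟩ := List.mem_map.1 hs'
    simp
  path_cost := by
    intro s hs
    obtain ⟨_, _, rfl⟩ := List.mem_map.1 hs
    simp
  path_tail := by
    intro s hs
    obtain ⟨_, _, rfl⟩ := List.mem_map.1 hs
    simp
  path_cover := by
    intro s hs A hA h
    obtain ⟨x, hx, rfl⟩ := List.mem_map.1 hs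
    exact absurd (nodeList_subset.2 (hS.core_subset A hA) x hx) h

/-- The settled nodes form a member of the family. -/
theorem Settled.exists_eq {st : List (Entry n m)} (h : Settled edge cost H st) :
    ∃ B, H B ∧ ∀ x, x ∈ nodeList B ↔ ∃ s ∈ st, s.1 = x := by
  obtain ⟨B, hB, hx⟩ := h.level ((st.map fun s => s.2.1).sum + 1) (by omega)
  refine ⟨B, hB, fun x => (hx x).trans (exists_congr fun s => and_congr_right fun hs =>
    and_iff_left ?_)⟩
  exact Nat.lt_succ_of_le (List.le_sum_of_mem (List.mem_map.2 ⟨s, hs, rfl⟩))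

/-- An extension of least distance is processed correctly. -/
theorem Settled.settle (hS : SearchSpace edge H C cl) {st : List (Entry n m)}
    (h : Settled edge cost H st) {e : Fin m} {s : Entry n m}
    (htail : ∀ s' ∈ st, s'.1 ≠ (edge e).1) (hs : s ∈ st) (hhead : s.1 = (edge e).2)
    (hmin : ∀ e', ∀ s' ∈ st, s'.1 = (edge e').2 → (∀ t ∈ st, t.1 ≠ (edge e').1) →
      s.2.1 + cost e ≤ s'.2.1 + cost e') :
    (∃ st', settle cl (st, []) ((edge e).1, s.2.1 + cost e, e :: s.2.2) = (st', []) ∧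
      st.length < st'.length ∧ Settled edge cost H st') ∨
    ∃ c, settle cl (st, []) ((edge e).1, s.2.1 + cost e, e :: s.2.2) = (st, [c]) ∧
      Finished edge cost H st c := by
  obtain ⟨B₀, hB₀, hB₀x⟩ := h.exists_eq
  have hmono : ∀ t ∈ st, t.2.1 ≤ s.2.1 + cost e := fun t ht => h.frontier e s hs hhead htail t ht
  have hcost : ((e :: s.2.2).map cost).sum = s.2.1 + cost e := by
    rw [List.map_cons, List.sum_cons, h.path_cost s hs, add_comm]
  have hcover : ∀ A, H A → (edge e).1 ∉ nodeList A → ∃ e' ∈ e :: s.2.2, Enters (edge e') A := by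
    intro A hA hx
    by_cases hsA : s.1 ∈ nodeList A
    · exact ⟨e, by simp, enters_iff.2 ⟨hx, hhead ▸ hsA⟩⟩
    · obtain ⟨e', he', h'⟩ := h.path_cover s hs A hA hsA
      exact ⟨e', by simp [he'], h'⟩
  have hxC : (edge e).1 ∉ nodeList C := fun hx => by
    obtain ⟨t, ht, htx⟩ := (hB₀x _).1 (nodeList_subset.2 (hS.core_subset _ hB₀) _ hx)
    exact htail t ht htx
  rcases hS.closure _ hxC with ⟨hnil, hout⟩ | ⟨B, hcl, hB, hxB, hBmin⟩
  · right
    refine ⟨((edge e).1, s.2.1 + cost e, e :: s.2.2), by simp [EdgeCover.settle, hnil],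
      fun e' s' hs' h1 h2 => hmin e' s' hs' h1 h2,
      hcost, fun A hA => hcover A hA (hout A hA)⟩
  · left
    set new : List (Entry n m) := ((nodeList B).filter fun y => decide ¬ ∃ s ∈ st, s.1 = y).map
      fun y => (y, s.2.1 + cost e, e :: s.2.2) with hnew
    have hmem : ∀ t, t ∈ new ↔ (t.1 ∈ nodeList B ∧ ∀ s ∈ st, s.1 ≠ t.1) ∧
        t.2 = (s.2.1 + cost e, e :: s.2.2) := by
      rintro ⟨y, t⟩
      simp only [hnew, List.mem_map, List.mem_filter, decide_eq_true_eq, not_exists, not_and,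
        Prod.mk.injEq]
      constructor
      · rintro ⟨y, hy, rfl, rfl⟩; exact ⟨hy, rfl⟩
      · rintro ⟨hy, rfl⟩; exact ⟨y, hy, rfl, rfl⟩
    have hx : ((edge e).1, s.2.1 + cost e, e :: s.2.2) ∈ new :=
      (hmem _).2 ⟨⟨hxB, htail⟩, rfl⟩
    refine ⟨st ++ new, ?_, ?_, ?_⟩
    · have : nodeList B ≠ [] := List.ne_nil_of_mem hxB
      simp only [EdgeCover.settle, hcl, this, if_false, hnew]
    · have := List.length_pos_of_mem hx
      rw [List.length_append]; omega
    have hall : ∀ x, x ∈ nodeList (B₀ ∪ B) ↔ ∃ t ∈ st ++ new, t.1 = x := by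
      intro x
      have h1 : x ∈ nodeList (B₀ ∪ B) ↔ x ∈ nodeList B₀ ∨ x ∈ nodeList B := by
        simp only [mem_nodeList, Finset.mem_union, or_and_right, exists_or]
      rw [h1, hB₀x]
      constructor
      · rintro (⟨t, ht, rfl⟩ | hxB)
        · exact ⟨t, by simp [ht], rfl⟩
        · by_cases hx : ∃ t ∈ st, t.1 = x
          · obtain ⟨t, ht, rfl⟩ := hx
            exact ⟨t, by simp [ht], rfl⟩
          · push Not at hx
            exact ⟨(x, _), List.mem_append_right _ ((hmem _).2 ⟨⟨hxB, hx⟩, rfl⟩), rfl⟩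
      · rintro ⟨t, ht, rfl⟩
        rcases List.mem_append.1 ht with ht | ht
        · exact .inl ⟨t, ht, rfl⟩
        · exact .inr ((hmem t).1 ht).1.1
    refine ⟨?_, ?_, ?_, ?_, ?_, ?_, ?_⟩
    · rw [List.map_append, List.nodup_append]
      refine ⟨h.nodup, ?_, ?_⟩
      · rw [hnew, List.map_map]
        exact ((nodup_nodeList B).filter _).map fun _ _ h => h
      · intro x hx y hy
        obtain ⟨t, ht, rfl⟩ := List.mem_map.1 hx
        obtain ⟨t', ht', rfl⟩ := List.mem_map.1 hy
        exact ((hmem t').1 ht').1.2 t ht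
    · intro θ hθ
      by_cases hd : s.2.1 + cost e < θ
      · refine ⟨B₀ ∪ B, hS.union _ _ hB₀ hB, fun x => (hall x).trans (exists_congr fun t =>
          and_congr_right fun ht => (and_iff_left ?_).symm)⟩
        rcases List.mem_append.1 ht with ht | ht
        · exact (hmono t ht).trans_lt hd
        · rw [((hmem t).1 ht).2]; exact hd
      · obtain ⟨B', hB', hx'⟩ := h.level θ hθ
        refine ⟨B', hB', fun x => (hx' x).trans ⟨?_, ?_⟩⟩
        · rintro ⟨t, ht, h1⟩; exact ⟨t, by simp [ht], h1⟩
        · rintro ⟨t, ht, h1, h2⟩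
          rcases List.mem_append.1 ht with ht | ht
          · exact ⟨t, ht, h1, h2⟩
          · rw [((hmem t).1 ht).2] at h2; exact absurd h2 hd
    · intro e' t ht hth t' ht' htt
      rcases List.mem_append.1 ht with ht | ht <;> rcases List.mem_append.1 ht' with ht' | ht'
      · exact h.triangle e' t ht hth t' ht' htt
      · rw [((hmem t').1 ht').2]
        exact hmin e' t ht hth fun t'' ht'' => htt ▸ ((hmem t').1 ht').1.2 t'' ht''
      · rw [((hmem t).1 ht).2]
        have := hmono t' ht'
        dsimp only; omega
      · rw [((hmem t).1 ht).2, ((hmem t').1 ht').2]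
        dsimp only; omega
    · intro e' t ht hth hout t' ht'
      have hle : t'.2.1 ≤ s.2.1 + cost e := by
        rcases List.mem_append.1 ht' with ht' | ht'
        · exact hmono t' ht'
        · rw [((hmem t').1 ht').2]
      rcases List.mem_append.1 ht with ht | ht
      · exact hle.trans (hmin e' t ht hth fun t'' ht'' => hout t'' (by simp [ht'']))
      · rw [((hmem t).1 ht).2]
        dsimp only; omega
    · intro t ht
      rcases List.mem_append.1 ht with ht | ht
      · exact h.path_cost t ht
      · rw [((hmem t).1 ht).2]; exact hcost
    · intro t ht e' he'
      rcases List.mem_append.1 ht with ht | ht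
      · obtain ⟨t', ht', h'⟩ := h.path_tail t ht e' he'
        exact ⟨t', by simp [ht'], h'⟩
      · rw [((hmem t).1 ht).2] at he'
        rcases List.mem_cons.1 he' with rfl | he'
        · exact ⟨_, List.mem_append_right _ hx, rfl⟩
        · obtain ⟨t', ht', h'⟩ := h.path_tail s hs e' he'
          exact ⟨t', by simp [ht'], h'⟩
    · intro t ht A hA htA
      rcases List.mem_append.1 ht with ht | ht
      · exact h.path_cover t ht A hA htA
      · rw [((hmem t).1 ht).2]
        refine hcover A hA fun hxA => htA ?_
        exact nodeList_subset.2 (hBmin A hA hxA) _ ((hmem t).1 ht).1.1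

variable (edge cost) in
/-- The edges of a network with integral costs as arcs. -/
def arcList : List (Arc n m) := (List.finRange m).map fun e => (e, edge e, cost e)

/-- One step settles a new node or ends the search. -/
theorem Settled.searchStep (hS : SearchSpace edge H C cl) {st : List (Entry n m)}
    (h : Settled edge cost H st) :
    (∃ st', searchStep (arcList edge cost) cl (st, []) = (st', []) ∧ st.length < st'.length ∧
      Settled edge cost H st') ∨
    ∃ c, searchStep (arcList edge cost) cl (st, []) = (st, [c]) ∧ Finished edge cost H st c := by
  have hmem : ∀ c, c ∈ extensions (arcList edge cost) st ↔ ∃ e, (∀ s ∈ st, s.1 ≠ (edge e).1) ∧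
      ∃ s ∈ st, s.1 = (edge e).2 ∧ c = ((edge e).1, s.2.1 + cost e, e :: s.2.2) := by
    intro c
    rw [mem_extensions]
    simp [arcList]
  obtain ⟨B, hB, hBx⟩ := h.exists_eq
  obtain ⟨e₀, he₀⟩ := hS.covered B hB
  rw [enters_iff, hBx, hBx] at he₀
  have hne : extensions (arcList edge cost) st ≠ [] := by
    obtain ⟨h1, s, hs, h2⟩ := he₀
    exact List.ne_nil_of_mem ((hmem _).2 ⟨e₀, fun t ht hte => h1 ⟨t, ht, hte⟩, s, hs, h2, rfl⟩)
  obtain ⟨c, hc, hpick, hmin⟩ := pick_eq EntryLe _ hne (fun x _ => le_refl x.2.1)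
    (fun x _ y _ => le_total x.2.1 y.2.1)
    (fun x _ y _ z _ (h1 : x.2.1 ≤ y.2.1) (h2 : y.2.1 ≤ z.2.1) => h1.trans h2)
  obtain ⟨e, htail, s, hs, hhead, rfl⟩ := (hmem c).1 hc
  have hstep : EdgeCover.searchStep (arcList edge cost) cl (st, []) =
      EdgeCover.settle cl (st, []) ((edge e).1, s.2.1 + cost e, e :: s.2.2) := by
    simp [EdgeCover.searchStep, hpick]
  rw [hstep]
  exact h.settle hS htail hs hhead fun e' s' hs' h1 h2 =>
    hmin _ ((hmem _).2 ⟨e', h2, s', hs', h1, rfl⟩)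

theorem Settled.length_le {st : List (Entry n m)} (h : Settled edge cost H st) :
    st.length ≤ n := by
  obtain ⟨B, -, hB⟩ := h.exists_eq
  have h1 : (st.map Prod.fst).Subperm (nodeList B) := h.nodup.subperm fun x hx => by
    obtain ⟨s, hs, rfl⟩ := List.mem_map.1 hx
    exact (hB _).2 ⟨s, hs, rfl⟩
  simpa using h1.length_le.trans (by simpa [nodeList] using Finset.card_le_univ B)

/-- The search ends with a path from outside. -/
theorem search_spec (hS : SearchSpace edge H C cl) {nodes : List (Option (Fin n))}
    (hn : n ≤ nodes.length) : ∃ st c,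
      search (arcList edge cost) cl nodes (nodeList C) = (st, [c]) ∧ Settled edge cost H st ∧
        Finished edge cost H st c := by
  have key : ∀ l : List (Option (Fin n)),
      (∃ st, l.foldl (fun S _ => EdgeCover.searchStep (arcList edge cost) cl S)
        ((nodeList C).map fun c => ((c, 0, []) : Entry n m), []) = (st, []) ∧
        l.length < st.length ∧ Settled edge cost H st) ∨
      ∃ st c, l.foldl (fun S _ => EdgeCover.searchStep (arcList edge cost) cl S)
        ((nodeList C).map fun c => ((c, 0, []) : Entry n m), []) = (st, [c]) ∧
        Settled edge cost H st ∧ Finished edge cost H st c := by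
    intro l
    induction l using List.reverseRecOn with
    | nil =>
      refine .inl ⟨_, rfl, ?_, settled_init hS⟩
      simpa [nodeList] using hS.core_nonempty
    | append_singleton l a ih =>
      simp only [List.foldl_append, List.foldl_cons, List.foldl_nil]
      rcases ih with ⟨st, h1, h2, h3⟩ | ⟨st, c, h1, h2, h3⟩
      · rw [h1]
        rcases h3.searchStep hS with ⟨st', h4, h5, h6⟩ | ⟨c, h4, h5⟩
        · refine .inl ⟨st', h4, ?_, h6⟩
          rw [List.length_append, List.length_singleton]; omega
        · exact .inr ⟨st, c, h4, h3, h5⟩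
      · rw [h1]
        exact .inr ⟨st, c, by simp [EdgeCover.searchStep], h2, h3⟩
  rcases key nodes with ⟨st, -, h2, h3⟩ | h
  · have := h3.length_le; omega
  · exact h

end Search

end EdgeCover

/-! ### The residual family, its halos and the closure operator -/

namespace EdgeCover

open Machine Data Enc

/-- If every set of `𝒟`, a set of cores of a `T`-intersecting family, contains a set of `𝒬`, and
the sets of `𝒬` meet `T`, then `𝒟` has at most as many members as `𝒬`. -/
theorem card_le_of_forall_subset {n : ℕ} {T : Finset (Fin n)} {F 𝒟 𝒬 : Finset (Finset (Fin n))}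
    (hF : ∀ A ∈ F, ∀ B ∈ F, (A ∩ B ∩ T).Nonempty → A ∩ B ∈ F)
    (h𝒟 : 𝒟 ⊆ cores F) (h𝒬 : ∀ C ∈ 𝒬, (C ∩ T).Nonempty) (h : ∀ D ∈ 𝒟, ∃ C ∈ 𝒬, C ⊆ D) :
    𝒟.card ≤ 𝒬.card := by
  choose! φ h1 h2 using h
  refine Finset.card_le_card_of_injOn φ h1 fun D hD D' hD' he => ?_
  obtain ⟨t, ht⟩ := h𝒬 _ (h1 D hD)
  have h3 := h2 D hD
  have h4 := h2 D' hD'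
  rw [← he] at h4
  rw [Finset.mem_inter] at ht
  refine core_eq_of_inter hF (h𝒟 hD) (h𝒟 hD') ⟨t, ?_⟩
  simp [h3 ht.1, h4 ht.1, ht.2]

namespace Instance

variable (ι : Instance)

/-- The family of the sets of maximum value that are not covered by `X`. -/
noncomputable def family (X : Finset (Fin ι.G.m)) : Finset (Finset (Fin ι.G.n)) :=
  ι.G.residualFamily (topFamily ι.f) X

variable {ι} {X : Finset (Fin ι.G.m)} {A B C D : Finset (Fin ι.G.n)}

theorem mem_family : A ∈ ι.family X ↔ ι.f A = maxVal ι.f ∧ ∀ e ∈ X, ¬ Enters (ι.G.edge e) A := by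
  classical
  rw [family, Network.residualFamily, Finset.mem_filter, mem_topFamily, Network.deg,
    Finset.card_eq_zero, Finset.filter_eq_empty_iff]

theorem f_pos (h : A ∈ ι.family X) : 0 < ι.f A := (mem_family.1 h).1 ▸ ι.pos

theorem family_meets (h : A ∈ ι.family X) : (A ∩ ι.G.T).Nonempty := ι.meets A (f_pos h)

theorem family_inter_union (hA : A ∈ ι.family X) (hB : B ∈ ι.family X)
    (h : (A ∩ B ∩ ι.G.T).Nonempty) : A ∩ B ∈ ι.family X ∧ A ∪ B ∈ ι.family X := by
  have h1 := ι.supermodular A B h (f_pos hA) (f_pos hB)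
  have h2 := le_maxVal ι.f (A ∩ B)
  have h3 := le_maxVal ι.f (A ∪ B)
  simp only [mem_family] at *
  refine ⟨⟨by omega, fun e he h' => ?_⟩, by omega, fun e he h' => ?_⟩
  · exact ((enters_inter_union _).1 h').elim (hA.2 e he) (hB.2 e he)
  · exact ((enters_inter_union _).2.1 h').elim (hA.2 e he) (hB.2 e he)

theorem family_inter : ∀ A ∈ ι.family X, ∀ B ∈ ι.family X,
    (A ∩ B ∩ ι.G.T).Nonempty → A ∩ B ∈ ι.family X :=
  fun _ hA _ hB h => (family_inter_union hA hB h).1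

theorem family_anti {Y : Finset (Fin ι.G.m)} (h : X ⊆ Y) (hA : A ∈ ι.family Y) :
    A ∈ ι.family X :=
  mem_family.2 ⟨(mem_family.1 hA).1, fun e he => (mem_family.1 hA).2 e (h he)⟩

theorem mem_of_core (h : C ∈ cores (ι.family X)) : C ∈ ι.family X := (mem_cores.1 h).1

/-- The halo of a core `C`: the members of the residual family that contain `C` and no other
core. -/
def Halo (ι : Instance) (C A : Finset (Fin ι.G.n)) : Prop :=
  A ∈ ι.family ι.I ∧ C ⊆ A ∧ ∀ D ∈ cores (ι.family ι.I), D ⊆ A → D = C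

theorem halo_core (hC : C ∈ cores (ι.family ι.I)) : ι.Halo C C :=
  ⟨mem_of_core hC, subset_rfl, fun D hD h => (mem_cores.1 hC).2 D (mem_of_core hD) h⟩

theorem inter_nonempty_of_core (hC : C ∈ cores (ι.family ι.I)) (hA : C ⊆ A) (hB : C ⊆ B) :
    (A ∩ B ∩ ι.G.T).Nonempty :=
  (family_meets (mem_of_core hC)).mono
    (Finset.inter_subset_inter_right (Finset.subset_inter hA hB))

theorem Halo.inter (hC : C ∈ cores (ι.family ι.I)) (hA : ι.Halo C A) (hB : B ∈ ι.family ι.I)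
    (hCB : C ⊆ B) : ι.Halo C (B ∩ A) :=
  ⟨family_inter _ hB _ hA.1 (inter_nonempty_of_core hC hCB hA.2.1),
    Finset.subset_inter hCB hA.2.1,
    fun D hD h => hA.2.2 D hD (h.trans Finset.inter_subset_right)⟩

theorem Halo.union (hC : C ∈ cores (ι.family ι.I)) (hA : ι.Halo C A) (hB : ι.Halo C B) :
    ι.Halo C (A ∪ B) := by
  refine ⟨(family_inter_union hA.1 hB.1 (inter_nonempty_of_core hC hA.2.1 hB.2.1)).2,
    hA.2.1.trans Finset.subset_union_left, fun D hD h => ?_⟩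
  -- A terminal of `D` lies in `A` or in `B`, which then contains `D`.
  obtain ⟨t, ht⟩ := family_meets (mem_of_core hD)
  rw [Finset.mem_inter] at ht
  rcases Finset.mem_union.1 (h ht.1) with htA | htB
  · exact hA.2.2 D hD (core_subset_of_inter family_inter hD hA.1 ⟨t, by simp [ht, htA]⟩)
  · exact hB.2.2 D hD (core_subset_of_inter family_inter hD hB.1 ⟨t, by simp [ht, htB]⟩)

/-- The halos of different cores have no terminal in common. -/
theorem Halo.eq_of_inter (hA : ι.Halo C A) (hB : ι.Halo D B) (h : (A ∩ B ∩ ι.G.T).Nonempty) :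
    C = D := by
  obtain ⟨E, hE, hEs⟩ := exists_core_subset (family_inter _ hA.1 _ hB.1 h)
  rw [← hA.2.2 E hE (hEs.trans Finset.inter_subset_left)]
  exact hB.2.2 E hE (hEs.trans Finset.inter_subset_right)

theorem listDeg_baseQuery : listDeg ι.baseQuery A = 0 ↔ ∀ e ∈ ι.I, ¬ Enters (ι.G.edge e) A := by
  rw [listDeg_eq_zero]
  simp only [baseQuery, Network.arcs, List.mem_map, List.mem_filter, List.mem_finRange, true_and,
    decide_eq_true_eq, Finset.mem_sort]
  constructor
  · exact fun h e he => h _ ⟨_, ⟨⟨e, rfl⟩, he⟩, rfl⟩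
  · rintro h _ ⟨_, ⟨⟨e, rfl⟩, he⟩, rfl⟩
    exact h e he

/-- If some set of maximum value is not entered by the query, then the answer concerns exactly
these sets. -/
theorem mem_topFamily_residual {L : List (Option (Fin ι.G.n) × Option (Fin ι.G.n))}
    (hA : ι.f A = maxVal ι.f) (hL : listDeg L A = 0) :
    B ∈ topFamily (residual ι.f L) ↔ ι.f B = maxVal ι.f ∧ listDeg L B = 0 := by
  have hpos := ι.pos
  have hmax : maxVal (residual ι.f L) = maxVal ι.f := by
    refine maxVal_eq (A := A) ?_ fun D => ?_
    · simp only [residual, hA, hL]; omega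
    · have := le_maxVal ι.f D
      simp only [residual]; omega
  rw [mem_topFamily, hmax]
  have := le_maxVal ι.f B
  simp only [residual]; omega

theorem exists_core (ι : Instance) : ∃ C, C ∈ cores (ι.family ι.I) := by
  have h := ι.nu_pos
  exact Finset.card_pos.1 h

theorem mem_coreList : C ∈ ι.coreList ι.baseQuery ↔ C ∈ cores (ι.family ι.I) := by
  obtain ⟨A, hA⟩ := ι.exists_core
  have hA := mem_family.1 (mem_of_core hA)
  rw [(ι.oracle_spec _).2.1]
  have : topFamily (residual ι.f ι.baseQuery) = ι.family ι.I := by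
    ext B
    rw [mem_topFamily_residual hA.1 (listDeg_baseQuery.2 hA.2), listDeg_baseQuery, mem_family]
  rw [this]

theorem mem_coreLists {l} : l ∈ ι.coreLists ↔ ∃ C ∈ cores (ι.family ι.I), nodeList C = l := by
  simp only [coreLists, answer, List.mem_map, mem_coreList]

theorem listDeg_append {n : ℕ} (L L' : List (Option (Fin n) × Option (Fin n)))
    (A : Finset (Fin n)) : listDeg (L ++ L') A = listDeg L A + listDeg L' A := by
  simp [listDeg]

/-- The edges of the closure query but the first: they leave exactly the halo uncovered. -/
theorem halo_iff (hA : ι.f A = maxVal ι.f) (x : Option (Fin ι.G.n)) :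
    listDeg (ι.closureQuery (nodeList C) x).tail A = 0 ↔ ι.Halo C A := by
  have hpos : 0 < ι.f A := hA ▸ ι.pos
  rw [closureQuery, List.tail_cons, listDeg_append, listDeg_append, Nat.add_eq_zero_iff,
    Nat.add_eq_zero_iff, listDeg_baseQuery]
  have h2 : listDeg ((nodeList C).flatMap fun c => ι.nodes.map fun w => (c, w)) A = 0 ↔
      C ⊆ A := by
    rw [listDeg_eq_zero]
    simp only [List.mem_flatMap, List.mem_map, forall_exists_index, and_imp, enters_iff]
    constructor
    · intro h c hc
      obtain ⟨w, hw⟩ := (ι.meets A hpos).mono Finset.inter_subset_left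
      by_contra hcA
      exact h _ (some c) (by simpa) (some w) (by simp [nodes]) rfl ⟨by simpa using hcA, by simpa⟩
    · rintro h _ c hc w - rfl ⟨h1, -⟩
      exact h1 (nodeList_subset.2 h c hc)
  have h3 : listDeg (ι.coreLists.flatMap fun D => if D = nodeList C then [] else
      (D.filter fun t => decide (t ∈ nodeList ι.G.T)).map fun t => ((none : Option _), t)) A = 0 ↔
      ∀ D ∈ cores (ι.family ι.I), (A ∩ D ∩ ι.G.T).Nonempty → D = C := by
    rw [listDeg_eq_zero]
    simp only [List.mem_flatMap, mem_coreLists, enters_iff]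
    constructor
    · rintro h D hD ⟨t, ht⟩
      simp only [Finset.mem_inter] at ht
      by_contra hne
      refine h (none, some t) ⟨nodeList D, ⟨D, hD, rfl⟩, ?_⟩ (by simp [ht.1.1])
      rw [if_neg (nodeList_injective.ne hne)]
      simp [ht.1.2, ht.2]
    · rintro h e ⟨-, ⟨D, hD, rfl⟩, he⟩ ⟨-, he2⟩
      split_ifs at he with hDC
      · simp at he
      · simp only [List.mem_map, List.mem_filter, decide_eq_true_eq] at he
        obtain ⟨t, ⟨htD, htT⟩, rfl⟩ := he
        obtain ⟨v, hv, rfl⟩ := mem_nodeList.1 htD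
        simp only [some_mem_nodeList] at htT he2
        exact hDC (congrArg _ (h D hD ⟨v, by simp [hv, htT, he2]⟩))
  rw [h2, h3]
  constructor
  · rintro ⟨h, hCA, hD⟩
    refine ⟨mem_family.2 ⟨hA, h⟩, hCA, fun D hD' hDA => hD D hD' ?_⟩
    rw [Finset.inter_eq_right.2 hDA]
    exact family_meets (mem_of_core hD')
  · rintro ⟨h, hCA, hD⟩
    exact ⟨(mem_family.1 h).2, hCA, fun D hD' hDA =>
      hD D hD' (core_subset_of_inter family_inter hD' h hDA)⟩

theorem closure_spec (hC : C ∈ cores (ι.family ι.I)) {x : Option (Fin ι.G.n)}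
    (hx : x ∉ nodeList C) :
    (ι.closure (nodeList C) x = [] ∧ ∀ A, ι.Halo C A → x ∉ nodeList A) ∨
    ∃ B, ι.closure (nodeList C) x = nodeList B ∧ ι.Halo C B ∧ x ∈ nodeList B ∧
      ∀ A, ι.Halo C A → x ∈ nodeList A → B ⊆ A := by
  classical
  set L := ι.closureQuery (nodeList C) x with hL
  obtain ⟨t₀, ht₀, hhead⟩ : ∃ t ∈ C, (nodeList C).headD none = some t := by
    have hne : nodeList C ≠ [] := by
      obtain ⟨t, ht⟩ := family_meets (mem_of_core hC)
      exact List.ne_nil_of_mem (some_mem_nodeList.2 (Finset.mem_inter.1 ht).1)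
    cases hl : nodeList C with
    | nil => exact absurd hl hne
    | cons a l =>
      obtain ⟨t, ht, h⟩ := mem_nodeList.1 (hl ▸ List.mem_cons_self : a ∈ nodeList C)
      exact ⟨t, ht, by simp [h]⟩
  have hdeg : ∀ A, listDeg L A = listDeg L.tail A + if Enters (x, some t₀) A then 1 else 0 := by
    intro A
    rw [← hhead, ← listDeg_cons]
    rfl
  have hzero : ∀ A, ι.f A = maxVal ι.f → (listDeg L A = 0 ↔ ι.Halo C A ∧ x ∈ nodeList A) := by
    intro A hA
    rw [hdeg, Nat.add_eq_zero_iff, hL, halo_iff hA]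
    refine and_congr_right fun h => ?_
    have : t₀ ∈ A := h.2.1 ht₀
    simp [enters_iff, this]
  have hfC := (mem_family.1 (mem_of_core hC)).1
  obtain ⟨hnd, hmem, -⟩ := ι.oracle_spec L
  by_cases hex : ∃ A, ι.Halo C A ∧ x ∈ nodeList A
  · right
    obtain ⟨A₀, hA₀, hxA₀⟩ := hex
    have hfA₀ := (mem_family.1 hA₀.1).1
    have htop : ∀ B, B ∈ topFamily (residual ι.f L) ↔ ι.Halo C B ∧ x ∈ nodeList B := by
      intro B
      rw [mem_topFamily_residual hfA₀ ((hzero _ hfA₀).2 ⟨hA₀, hxA₀⟩)]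
      exact ⟨fun h => (hzero _ h.1).1 h.2,
        fun h => ⟨(mem_family.1 h.1.1).1, (hzero _ (mem_family.1 h.1.1).1).2 h⟩⟩
    obtain ⟨B, hB, -⟩ := exists_core_subset ((htop A₀).2 ⟨hA₀, hxA₀⟩)
    have hB' := (htop B).1 (mem_cores.1 hB).1
    have hmin : ∀ A, ι.Halo C A → x ∈ nodeList A → B ⊆ A := by
      intro A hA hxA
      have h1 : ι.Halo C (A ∩ B) := hB'.1.inter hC hA.1 hA.2.1
      have h2 : x ∈ nodeList (A ∩ B) := by
        obtain ⟨v, hv, rfl⟩ := mem_nodeList.1 hxA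
        simpa [hv] using hB'.2
      have := (mem_cores.1 hB).2 _ ((htop _).2 ⟨h1, h2⟩) Finset.inter_subset_right
      exact Finset.inter_eq_right.1 this
    have hall : ∀ A ∈ ι.coreList L, A = B := by
      intro A hA
      have hA := (hmem A).1 hA
      have hA' := (htop A).1 (mem_cores.1 hA).1
      exact ((mem_cores.1 hA).2 B (mem_cores.1 hB).1 (hmin A hA'.1 hA'.2)).symm
    have hlist : ι.coreList L = [B] := by
      have h1 := (hmem B).2 hB
      cases hl : ι.coreList L with
      | nil => rw [hl] at h1; simp at h1
      | cons a l =>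
        rw [hl] at hnd hall
        have ha := hall a (by simp)
        cases l with
        | nil => rw [ha]
        | cons b l =>
          have hb := hall b (by simp)
          simp [ha, hb] at hnd
    refine ⟨B, ?_, hB'.1, hB'.2, hmin⟩
    simp only [closure, answer, ← hL, hlist, List.map_cons, List.map_nil, List.tail_cons,
      List.headD_cons, hB'.2, and_self, if_true]
  · left
    push Not at hex
    refine ⟨?_, hex⟩
    -- The core `C` is entered only by the first edge of the query, so it attains the maximum.
    have hdegC : listDeg L C = 1 := by
      rw [hdeg, (halo_iff hfC x).2 (halo_core hC), if_pos (enters_iff.2 ⟨hx, by simpa⟩)]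
    have hpos := ι.pos
    have hCtop : C ∈ topFamily (residual ι.f L) := by
      have : maxVal (residual ι.f L) = maxVal ι.f - 1 := by
        refine maxVal_eq (A := C) ?_ fun D => ?_
        · simp only [residual, hfC, hdegC]; omega
        · have h1 := le_maxVal ι.f D
          have h2 : ι.f D = maxVal ι.f → listDeg L D ≠ 0 := fun h3 h4 =>
            hex D ((hzero D h3).1 h4).1 ((hzero D h3).1 h4).2
          simp only [residual]; omega
      rw [mem_topFamily, this]
      simp only [residual, hfC, hdegC]; omega
    obtain ⟨B, hB, hBC⟩ := exists_core_subset hCtop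
    have h1 := (hmem B).2 hB
    simp only [closure, answer, ← hL]
    refine if_neg ?_
    rintro ⟨ht, hh⟩
    cases hl : ι.coreList L with
    | nil => rw [hl] at h1; simp at h1
    | cons a l =>
      rw [hl] at ht hh h1
      simp only [List.map_cons, List.tail_cons, List.map_eq_nil_iff, List.headD_cons] at ht hh
      subst ht
      rw [List.mem_singleton.1 h1] at hBC
      exact hx (nodeList_subset.2 hBC x hh)

theorem searchSpace (hC : C ∈ cores (ι.family ι.I)) :
    SearchSpace ι.G.edge (ι.Halo C) C (ι.closure (nodeList C)) where
  core := halo_core hC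
  core_nonempty := (family_meets (mem_of_core hC)).mono Finset.inter_subset_left
  union _ _ hA hB := hA.union hC hB
  core_subset _ hA := hA.2.1
  covered A hA := by
    classical
    obtain ⟨J, hJ⟩ := ι.coverable
    have h1 := hJ A
    have h2 := f_pos hA.1
    have h3 : 0 < ι.G.deg J A := by omega
    obtain ⟨e, he⟩ := Finset.card_pos.1 h3
    exact ⟨e, (Finset.mem_filter.1 he).2⟩
  closure _ hx := closure_spec hC hx

/-- The results of the searches. -/
theorem exists_runs (ι : Instance) : ∃ (st : Finset (Fin ι.G.n) → List (Entry ι.G.n ι.G.m))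
    (out : Finset (Fin ι.G.n) → Entry ι.G.n ι.G.m),
    ι.runs = (ι.coreList ι.baseQuery).map (fun C => (st C, [out C])) ∧
    ∀ C ∈ cores (ι.family ι.I), Settled ι.G.edge ι.G.scaledCost (ι.Halo C) (st C) ∧
      Finished ι.G.edge ι.G.scaledCost (ι.Halo C) (st C) (out C) := by
  have h : ∀ C : Finset (Fin ι.G.n), C ∈ cores (ι.family ι.I) →
      ∃ r : List (Entry ι.G.n ι.G.m) × Entry ι.G.n ι.G.m,
      search ι.G.arcs (ι.closure (nodeList C)) ι.nodes (nodeList C) = (r.1, [r.2]) ∧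
      Settled ι.G.edge ι.G.scaledCost (ι.Halo C) r.1 ∧
      Finished ι.G.edge ι.G.scaledCost (ι.Halo C) r.1 r.2 := by
    intro C hC
    obtain ⟨st, c, h1, h2, h3⟩ := search_spec (cost := ι.G.scaledCost) (searchSpace hC)
      (nodes := ι.nodes) ι.length_nodes.ge
    exact ⟨(st, c), h1, h2, h3⟩
  have : Nonempty (List (Entry ι.G.n ι.G.m) × Entry ι.G.n ι.G.m) := ⟨([], none, 0, [])⟩
  choose! r h1 h2 using h
  refine ⟨fun C => (r C).1, fun C => (r C).2, ?_, h2⟩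
  simp only [runs, coreLists, answer, List.map_map]
  exact List.map_congr_left fun C hC => h1 C (mem_coreList.1 hC)

end Instance

end EdgeCover

/-! ### Candidates reduce the number of cores -/

namespace EdgeCover

open Machine Data Enc

theorem length_flatMap_le {α β : Type} [DecidableEq α] (K : List α) (hK : K.Nodup)
    (F : α → List β) (hF : ∀ a ∈ K, (F a).length ≤ 1) :
    (K.flatMap F).length ≤ (K.toFinset.filter fun a => F a ≠ []).card := by
  rw [List.length_flatMap, ← List.sum_toFinset (fun a => (F a).length) hK, Finset.card_filter]
  refine Finset.sum_le_sum fun a ha => ?_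
  have := hF a (List.mem_toFinset.1 ha)
  split_ifs with h
  · exact this
  · simp [not_not.1 h]

theorem sum_le_sum_list {α : Type} [DecidableEq α] (S : Finset α) (l : List α) (c : α → ℕ)
    (h : ∀ a ∈ S, a ∈ l) : ∑ a ∈ S, c a ≤ (l.map c).sum := by
  calc ∑ a ∈ S, c a ≤ ∑ a ∈ l.dedup.toFinset, c a :=
        Finset.sum_le_sum_of_subset fun a ha => by simpa using h a ha
    _ = (l.dedup.map c).sum := List.sum_toFinset c l.nodup_dedup
    _ ≤ (l.map c).sum := (l.dedup_sublist.map c).sum_le_sum fun _ _ => Nat.zero_le _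

theorem sum_flatMap {α : Type} (l : List α) (g : α → List ℕ) :
    (l.flatMap g).sum = (l.map fun a => (g a).sum).sum := by
  induction l with
  | nil => rfl
  | cons a l ih => simp [ih]

namespace Instance

variable {ι : Instance} {X : Finset (Fin ι.G.m)} {A B C D : Finset (Fin ι.G.n)}

theorem nu_eq (X : Finset (Fin ι.G.m)) : ι.G.nu ι.f X = (cores (ι.family X)).card := rfl

/-- Covering the halo of a core decreases the number of cores: every new core contains an old one
different from `C`. -/
theorem nu_add_one_le (hX : ι.I ⊆ X) (hC : C ∈ cores (ι.family ι.I))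
    (hcov : ∀ A, ι.Halo C A → ∃ e ∈ X, Enters (ι.G.edge e) A) :
    ι.G.nu ι.f X + 1 ≤ ι.G.nu ι.f ι.I := by
  classical
  have h := card_le_of_forall_subset (𝒟 := cores (ι.family X))
    (𝒬 := (cores (ι.family ι.I)).erase C) family_inter subset_rfl
    (fun D hD => family_meets (mem_of_core (Finset.mem_of_mem_erase hD))) fun D hD => ?_
  · rw [Finset.card_erase_of_mem hC] at h
    have := Finset.card_pos.2 ⟨C, hC⟩
    simp only [nu_eq]; omega
  · have hD' := mem_of_core hD
    have hDI := family_anti hX hD'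
    by_contra! hno
    have hall : ∀ E ∈ cores (ι.family ι.I), E ⊆ D → E = C := fun E hE hED => by
      by_contra hne
      exact hno E (Finset.mem_erase.2 ⟨hne, hE⟩) hED
    obtain ⟨E, hE, hED⟩ := exists_core_subset hDI
    obtain ⟨e, he, hen⟩ := hcov D ⟨hDI, hall E hE hED ▸ hED, hall⟩
    exact (mem_family.1 hD').2 e he hen

/-- If any two uncovered sets that contain a core in `𝒬` have a common terminal, then all but one
of the cores in `𝒬` disappear. -/
theorem nu_add_card_le (hX : ι.I ⊆ X) {𝒬 : Finset (Finset (Fin ι.G.n))}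
    (h𝒬 : 𝒬 ⊆ cores (ι.family ι.I))
    (h : ∀ D ∈ ι.family X, ∀ D' ∈ ι.family X, (∃ C ∈ 𝒬, C ⊆ D) → (∃ C ∈ 𝒬, C ⊆ D') →
      (D ∩ D' ∩ ι.G.T).Nonempty) :
    ι.G.nu ι.f X + 𝒬.card ≤ ι.G.nu ι.f ι.I + 1 := by
  classical
  have h1 : ((cores (ι.family X)).filter fun D => ∃ C ∈ 𝒬, C ⊆ D).card ≤ 1 := by
    rw [Finset.card_le_one]
    intro D hD D' hD'
    rw [Finset.mem_filter] at hD hD'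
    exact core_eq_of_inter family_inter hD.1 hD'.1
      (h D (mem_of_core hD.1) D' (mem_of_core hD'.1) hD.2 hD'.2)
  have h2 : ((cores (ι.family X)).filter fun D => ¬ ∃ C ∈ 𝒬, C ⊆ D).card ≤
      (cores (ι.family ι.I) \ 𝒬).card := by
    refine card_le_of_forall_subset family_inter (Finset.filter_subset _ _)
      (fun D hD => family_meets (mem_of_core (Finset.mem_sdiff.1 hD).1)) fun D hD => ?_
    rw [Finset.mem_filter] at hD
    obtain ⟨E, hE, hED⟩ := exists_core_subset (family_anti hX (mem_of_core hD.1))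
    exact ⟨E, Finset.mem_sdiff.2 ⟨hE, fun hE' => hD.2 ⟨E, hE', hED⟩⟩, hED⟩
  have h3 := Finset.card_filter_add_card_filter_not (s := cores (ι.family X))
    (fun D => ∃ C ∈ 𝒬, C ⊆ D)
  have h4 := Finset.card_sdiff_add_card_eq_card h𝒬
  simp only [nu_eq]; omega

/-- An uncovered set that contains the core `C` contains the tail of the edge `e`, if `e` and a
path from its head to `C` have been bought. -/
theorem tail_mem (hX : ι.I ⊆ X) (hC : C ∈ cores (ι.family ι.I)) {st : List (Entry ι.G.n ι.G.m)}
    {cost : Fin ι.G.m → ℕ} (hst : Settled ι.G.edge cost (ι.Halo C) st)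
    {s : Entry ι.G.n ι.G.m} (hs : s ∈ st) {e : Fin ι.G.m} (hse : s.1 = (ι.G.edge e).2)
    (he : e ∈ X) (hpath : ∀ g ∈ s.2.2, g ∈ X) (hD : D ∈ ι.family X) (hCD : C ⊆ D) :
    (ι.G.edge e).1 ∈ nodeList D := by
  obtain ⟨B, hB, hBx⟩ := hst.exists_eq
  have hin : ∀ x, x ∈ nodeList (D ∩ B) ↔ x ∈ nodeList D ∧ x ∈ nodeList B := by
    intro x
    cases x <;> simp
  have hhead : s.1 ∈ nodeList D := by
    -- Otherwise an edge of the path enters `D ∩ B`; its tail lies in `B`, so that it enters `D`.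
    by_contra hsD
    obtain ⟨g, hg, hgen⟩ := hst.path_cover s hs (D ∩ B) (hB.inter hC (family_anti hX hD) hCD)
      fun h => hsD ((hin _).1 h).1
    rw [enters_iff, hin, hin] at hgen
    refine (mem_family.1 hD).2 g (hpath g hg) (enters_iff.2 ⟨fun h => hgen.1 ⟨h, ?_⟩, hgen.2.1⟩)
    exact (hBx _).2 (hst.path_tail s hs g hg)
  by_contra h
  exact (mem_family.1 hD).2 e he (enters_iff.2 ⟨h, hse ▸ hhead⟩)

/-- This is where quasi-bipartiteness is used: the head of an edge that lies in the halos of two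
cores is no terminal, so its tail is a terminal or lies in no positive set. -/
theorem inter_nonempty_of_tail {C' : Finset (Fin ι.G.n)} (hne : C ≠ C') (hA : ι.Halo C A)
    (hB : ι.Halo C' B) {e : Fin ι.G.m} (heA : (ι.G.edge e).2 ∈ nodeList A)
    (heB : (ι.G.edge e).2 ∈ nodeList B) {D' : Finset (Fin ι.G.n)} (hD : D ∈ ι.family X)
    (h : (ι.G.edge e).1 ∈ nodeList D) (h' : (ι.G.edge e).1 ∈ nodeList D') :
    (D ∩ D' ∩ ι.G.T).Nonempty := by
  obtain ⟨v, hv, hve⟩ := mem_nodeList.1 heA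
  rw [← hve, some_mem_nodeList] at heB
  have hvT : v ∉ ι.G.T := fun hvT => hne (hA.eq_of_inter hB ⟨v, by simp [hv, heB, hvT]⟩)
  have htail : ι.G.GoodEnd ι.f (ι.G.edge e).1 := by
    refine (ι.quasiBipartite e).resolve_right ?_
    rintro (⟨t, ht, h⟩ | h)
    · rw [← hve, Option.some.injEq] at h
      exact hvT (h ▸ ht)
    · exact h A (f_pos hA.1) v hv hve.symm
  obtain ⟨u, hu, hue⟩ := mem_nodeList.1 h
  rw [← hue, some_mem_nodeList] at h'
  rcases htail with ⟨t, ht, h⟩ | h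
  · rw [← hue, Option.some.injEq] at h
    exact ⟨u, by simp [hu, h', h ▸ ht]⟩
  · exact absurd hue.symm (h D (f_pos hD) u hu)

section Runs

variable {st : Finset (Fin ι.G.n) → List (Entry ι.G.n ι.G.m)}
  {out : Finset (Fin ι.G.n) → Entry ι.G.n ι.G.m}

theorem legs_eq (hr : ι.runs = (ι.coreList ι.baseQuery).map fun C => (st C, [out C]))
    (v : Option (Fin ι.G.n)) : legs ι.runs v =
      (ι.coreList ι.baseQuery).flatMap fun C => (st C).filter fun s => decide (s.1 = v) := by
  rw [legs, hr, List.flatMap_map]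

theorem single_mem (hr : ι.runs = (ι.coreList ι.baseQuery).map fun C => (st C, [out C]))
    (hC : C ∈ cores (ι.family ι.I)) :
    ((out C).2.1, 1, (out C).2.2) ∈ ι.candidates := by
  refine List.mem_append_left _ ?_
  simp only [singles, hr, List.mem_flatMap, List.mem_map]
  exact ⟨_, ⟨C, mem_coreList.2 hC, rfl⟩, by simp⟩

theorem star_mem {e : Fin ι.G.m} {s₀ : Entry ι.G.n ι.G.m} {Q : List (Entry ι.G.n ι.G.m)}
    (hs₀ : s₀ ∈ legs ι.runs (ι.G.edge e).2)
    (hQ : (legs ι.runs (ι.G.edge e).2).filter (fun s => decide (s.2.1 ≤ s₀.2.1)) = Q)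
    (hlen : 2 ≤ Q.length) :
    (ι.G.scaledCost e + (Q.map fun s => s.2.1).sum, Q.length - 1,
      e :: Q.flatMap fun s => s.2.2) ∈ ι.candidates := by
  refine List.mem_append_right _ (List.mem_flatMap.2 ⟨(e, ι.G.edge e, ι.G.scaledCost e), ?_, ?_⟩)
  · exact List.mem_map.2 ⟨e, List.mem_finRange e, rfl⟩
  · exact List.mem_flatMap.2 ⟨s₀, hs₀, by simp [star, hQ, hlen]⟩

theorem mem_candidates {c : Cand ι.G.m}
    (hr : ι.runs = (ι.coreList ι.baseQuery).map fun C => (st C, [out C]))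
    (hc : c ∈ ι.candidates) :
    (∃ C ∈ cores (ι.family ι.I), c = ((out C).2.1, 1, (out C).2.2)) ∨
    ∃ e s₀ Q, s₀ ∈ legs ι.runs (ι.G.edge e).2 ∧
      (legs ι.runs (ι.G.edge e).2).filter (fun s => decide (s.2.1 ≤ s₀.2.1)) = Q ∧
      2 ≤ Q.length ∧ c = (ι.G.scaledCost e + (Q.map fun s => s.2.1).sum, Q.length - 1,
        e :: Q.flatMap fun s => s.2.2) := by
  rcases List.mem_append.1 hc with hc | hc
  · left
    simp only [singles, hr, List.mem_flatMap, List.mem_map] at hc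
    obtain ⟨_, ⟨C, hC, rfl⟩, s, hs, rfl⟩ := hc
    rw [List.mem_singleton] at hs
    exact ⟨C, mem_coreList.1 hC, by rw [hs]⟩
  · right
    obtain ⟨a, ha, hc⟩ := List.mem_flatMap.1 hc
    obtain ⟨e, -, rfl⟩ := List.mem_map.1 ha
    obtain ⟨s₀, hs₀, hc⟩ := List.mem_flatMap.1 hc
    unfold star at hc
    split_ifs at hc with hlen
    · exact ⟨e, s₀, _, hs₀, rfl, hlen, List.mem_singleton.1 hc⟩
    · simp at hc

/-- The two numbers of a candidate are bounds for its cost and for the decrease of the number of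
cores. -/
theorem candidate_valid {c : Cand ι.G.m} (hc : c ∈ ι.candidates) :
    1 ≤ c.2.1 ∧ (c.2.2.map ι.G.scaledCost).sum ≤ c.1 ∧
      ∀ X, ι.I ⊆ X → (∀ e ∈ c.2.2, e ∈ X) → ι.G.nu ι.f X + c.2.1 ≤ ι.G.nu ι.f ι.I := by
  classical
  obtain ⟨st, out, hr, hspec⟩ := ι.exists_runs
  rcases mem_candidates hr hc with ⟨C, hC, rfl⟩ | ⟨e, s₀, Q, hs₀, hQ, hlen, rfl⟩
  · refine ⟨le_rfl, (hspec C hC).2.path_cost.le, fun X hX hp => nu_add_one_le hX hC fun A hA => ?_⟩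
    obtain ⟨e, he, h⟩ := (hspec C hC).2.path_cover A hA
    exact ⟨e, hp e he, h⟩
  · have hmemQ : ∀ s ∈ Q, ∃ C ∈ cores (ι.family ι.I), s ∈ st C ∧ s.1 = (ι.G.edge e).2 := by
      intro s hs
      rw [← hQ, List.mem_filter, legs_eq hr, List.mem_flatMap] at hs
      obtain ⟨⟨C, hC, hs⟩, -⟩ := hs
      rw [List.mem_filter, decide_eq_true_eq] at hs
      exact ⟨C, mem_coreList.1 hC, hs⟩
    refine ⟨by dsimp only; omega, ?_, fun X hX hp => ?_⟩
    · simp only [List.map_cons, List.sum_cons, List.map_flatMap]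
      refine Nat.add_le_add_left ?_ _
      rw [sum_flatMap]
      refine (List.map_congr_left fun s hs => ?_).symm ▸ le_rfl
      obtain ⟨C, hC, hs, -⟩ := hmemQ s hs
      exact (hspec C hC).1.path_cost s hs
    · -- The cores at which the legs of the star end.
      set F : Finset (Fin ι.G.n) → List (Entry ι.G.n ι.G.m) := fun C =>
        ((st C).filter fun s => decide (s.1 = (ι.G.edge e).2)).filter
          fun s => decide (s.2.1 ≤ s₀.2.1) with hF
      have hQF : Q = (ι.coreList ι.baseQuery).flatMap F := by
        rw [← hQ, legs_eq hr, List.filter_flatMap]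
      set 𝒬 := (ι.coreList ι.baseQuery).toFinset.filter fun C => F C ≠ [] with h𝒬
      have hcore : ∀ C ∈ 𝒬, C ∈ cores (ι.family ι.I) := fun C hC =>
        mem_coreList.1 (List.mem_toFinset.1 (Finset.mem_filter.1 hC).1)
      have hleg : ∀ C ∈ 𝒬, ∃ s ∈ st C, s.1 = (ι.G.edge e).2 ∧ s ∈ Q := by
        intro C hC
        obtain ⟨s, hs⟩ := List.exists_mem_of_ne_nil _ (Finset.mem_filter.1 hC).2
        have hs' := hs
        simp only [hF, List.mem_filter, decide_eq_true_eq] at hs'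
        refine ⟨s, hs'.1.1, hs'.1.2, ?_⟩
        rw [hQF]
        exact List.mem_flatMap.2 ⟨C, mem_coreList.2 (hcore C hC), hs⟩
      have hcard : Q.length ≤ 𝒬.card := by
        rw [hQF]
        refine length_flatMap_le _ (ι.oracle_spec _).1 F fun C hC => ?_
        have hnd := (hspec C (mem_coreList.1 hC)).1.nodup
        refine List.length_filter_le _ _ |>.trans ?_
        rw [← List.countP_eq_length_filter]
        have h1 := List.nodup_iff_count_le_one.1 hnd (ι.G.edge e).2
        rw [List.count, List.countP_map] at h1
        refine le_of_eq_of_le (List.countP_congr fun s _ => ?_) h1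
        simp
      have htail : ∀ D ∈ ι.family X, (∃ C ∈ 𝒬, C ⊆ D) → (ι.G.edge e).1 ∈ nodeList D := by
        rintro D hD ⟨C, hC, hCD⟩
        obtain ⟨s, hs, hse, hsQ⟩ := hleg C hC
        exact tail_mem hX (hcore C hC) (hspec C (hcore C hC)).1 hs hse (hp e (by simp))
          (fun g hg => hp g (List.mem_cons_of_mem _ (List.mem_flatMap.2 ⟨s, hsQ, hg⟩))) hD hCD
      obtain ⟨C, hC, C', hC', hne⟩ := Finset.one_lt_card.1 (show 1 < 𝒬.card by omega)
      have hhalo : ∀ C ∈ 𝒬, ∃ A, ι.Halo C A ∧ (ι.G.edge e).2 ∈ nodeList A := by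
        intro C hC
        obtain ⟨B, hB, hBx⟩ := (hspec C (hcore C hC)).1.exists_eq
        obtain ⟨s, hs, hse, -⟩ := hleg C hC
        exact ⟨B, hB, (hBx _).2 ⟨s, hs, hse⟩⟩
      obtain ⟨A, hA, heA⟩ := hhalo C hC
      obtain ⟨B, hB, heB⟩ := hhalo C' hC'
      have := nu_add_card_le hX hcore fun D hD D' hD' h h' =>
        inter_nonempty_of_tail hne hA hB heA heB hD (htail D hD h) (htail D' hD' h')
      dsimp only; omega

end Runs

/-! ### The lower bound on the cost of a cover -/

open Classical in
/-- The levels `i < a` at which the edge `e` enters the set of the nodes of distance at most `i`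
from a core, where distances are multiplied by `2 * b` so that levels are integers.  The dual
solution puts weight one on each of these level sets, so the number of these levels is what the
core charges to `e`. -/
noncomputable def crossedLevels (ι : Instance) (st : List (Entry ι.G.n ι.G.m)) (a b : ℕ)
    (e : Fin ι.G.m) : Finset ℕ :=
  (Finset.range a).filter fun i => (¬ ∃ s ∈ st, s.1 = (ι.G.edge e).1 ∧ 2 * b * s.2.1 ≤ i) ∧
    ∃ s ∈ st, s.1 = (ι.G.edge e).2 ∧ 2 * b * s.2.1 ≤ i

/-- Every cover enters each of the level sets of a core at least `k` times. -/
theorem le_sum_crossedLevels {st : List (Entry ι.G.n ι.G.m)} {cost : Fin ι.G.m → ℕ}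
    (hst : Settled ι.G.edge cost (ι.Halo C) st) {J : Finset (Fin ι.G.m)} (hJ : ι.G.Covers ι.f J)
    (a : ℕ) {b : ℕ} (hb : 1 ≤ b) :
    (maxVal ι.f).toNat * a ≤ ∑ e ∈ J, (ι.crossedLevels st a b e).card := by
  classical
  have hlevel : ∀ i, (maxVal ι.f).toNat ≤ (J.filter fun e =>
      (¬ ∃ s ∈ st, s.1 = (ι.G.edge e).1 ∧ 2 * b * s.2.1 ≤ i) ∧
        ∃ s ∈ st, s.1 = (ι.G.edge e).2 ∧ 2 * b * s.2.1 ≤ i).card := by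
    intro i
    obtain ⟨B, hB, hBx⟩ := hst.level (i / (2 * b) + 1) (Nat.succ_pos _)
    have hx : ∀ x, x ∈ nodeList B ↔ ∃ s ∈ st, s.1 = x ∧ 2 * b * s.2.1 ≤ i := by
      intro x
      rw [hBx]
      refine exists_congr fun s => and_congr_right fun _ => and_congr_right fun _ => ?_
      rw [Nat.lt_succ_iff, Nat.le_div_iff_mul_le (by omega), mul_comm]
    have h1 := hJ B
    rw [(mem_family.1 hB.1).1] at h1
    have h2 : ι.G.deg J B = (J.filter fun e =>
      (¬ ∃ s ∈ st, s.1 = (ι.G.edge e).1 ∧ 2 * b * s.2.1 ≤ i) ∧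
        ∃ s ∈ st, s.1 = (ι.G.edge e).2 ∧ 2 * b * s.2.1 ≤ i).card := by
      rw [Network.deg]
      congr 1
      refine Finset.filter_congr fun e _ => ?_
      rw [enters_iff, hx, hx]
    omega
  calc (maxVal ι.f).toNat * a = ∑ i ∈ Finset.range a, (maxVal ι.f).toNat := by
        rw [Finset.sum_const, Finset.card_range, smul_eq_mul, mul_comm]
    _ ≤ _ := Finset.sum_le_sum fun i _ => hlevel i
    _ = _ := by
      simp only [crossedLevels, Finset.card_filter]
      exact Finset.sum_comm

/-- A core charges an edge `uv` only if `v` has scaled distance less than `a`; then it charges at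
most the difference to `a`, and, by the triangle inequality, at most the cost of the edge. -/
theorem card_crossedLevels_le {st : List (Entry ι.G.n ι.G.m)} {out : Entry ι.G.n ι.G.m}
    {cost : Fin ι.G.m → ℕ} {H : Finset (Fin ι.G.n) → Prop} (hst : Settled ι.G.edge cost H st)
    (hout : Finished ι.G.edge cost H st out) {a b : ℕ} (hab : a ≤ out.2.1 * b) (e : Fin ι.G.m) :
    (ι.crossedLevels st a b e).card ≤ (((st.filter fun s => decide (s.1 = (ι.G.edge e).2)).filter
      fun s => decide (2 * b * s.2.1 < a)).map fun s => a - 2 * b * s.2.1).sum ∧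
    (ι.crossedLevels st a b e).card ≤ (((st.filter fun s => decide (s.1 = (ι.G.edge e).2)).filter
      fun s => decide (2 * b * s.2.1 < a)).map fun _ => 2 * b * cost e).sum := by
  classical
  rcases (ι.crossedLevels st a b e).eq_empty_or_nonempty with h0 | ⟨i, hi⟩
  · simp [h0]
  · simp only [crossedLevels, Finset.mem_filter, Finset.mem_range] at hi
    obtain ⟨hia, -, s, hs, hse, hsi⟩ := hi
    have hmem : s ∈ (st.filter fun s => decide (s.1 = (ι.G.edge e).2)).filter
        fun s => decide (2 * b * s.2.1 < a) := by
      simp only [List.mem_filter, decide_eq_true_eq]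
      exact ⟨⟨hs, hse⟩, by omega⟩
    have huniq : ∀ s' ∈ st, s'.1 = (ι.G.edge e).2 → s' = s := fun s' hs' h' =>
      List.inj_on_of_nodup_map hst.nodup hs' hs (h'.trans hse.symm)
    have hsub : ι.crossedLevels st a b e ⊆
        Finset.Ico (2 * b * s.2.1) (min a (2 * b * s.2.1 + 2 * b * cost e)) := by
      intro j hj
      simp only [crossedLevels, Finset.mem_filter, Finset.mem_range] at hj
      obtain ⟨hja, hno, s', hs', hse', hsj⟩ := hj
      rw [huniq s' hs' hse'] at hsj
      rw [Finset.mem_Ico, lt_min_iff]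
      refine ⟨hsj, hja, ?_⟩
      rw [← mul_add]
      by_cases hu : ∃ t ∈ st, t.1 = (ι.G.edge e).1
      · obtain ⟨t, ht, hte⟩ := hu
        have h1 : ¬ 2 * b * t.2.1 ≤ j := fun h => hno ⟨t, ht, hte, h⟩
        have h2 := Nat.mul_le_mul_left (2 * b) (hst.triangle e s hs hse t ht hte)
        omega
      · push Not at hu
        have h1 := Nat.mul_le_mul_left b (hout.frontier e s hs hse hu)
        have h2 : out.2.1 * b = b * out.2.1 := mul_comm _ _
        have h3 : 2 * b * (s.2.1 + cost e) = 2 * (b * (s.2.1 + cost e)) := mul_assoc _ _ _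
        omega
    have hcard := Finset.card_le_card hsub
    rw [Nat.card_Ico] at hcard
    constructor
    · refine le_trans ?_ (List.le_sum_of_mem (List.mem_map.2 ⟨s, hmem, rfl⟩))
      omega
    · refine le_trans ?_ (List.le_sum_of_mem (List.mem_map.2 ⟨s, hmem, rfl⟩))
      omega

/-- The dual solution is feasible: an edge is not charged more than its cost.  If at most one core
charges it, this is the triangle inequality; otherwise the edge and the paths from its head to the
charging cores form a star, whose ratio is at least `a / b`. -/
theorem sum_crossedLevels_le {st : Finset (Fin ι.G.n) → List (Entry ι.G.n ι.G.m)}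
    {out : Finset (Fin ι.G.n) → Entry ι.G.n ι.G.m}
    (hr : ι.runs = (ι.coreList ι.baseQuery).map fun C => (st C, [out C]))
    (hspec : ∀ C ∈ cores (ι.family ι.I),
      Settled ι.G.edge ι.G.scaledCost (ι.Halo C) (st C) ∧
      Finished ι.G.edge ι.G.scaledCost (ι.Halo C) (st C) (out C))
    {a b : ℕ} (hbest : ∀ c ∈ ι.candidates, a * c.2.1 ≤ c.1 * b) (e : Fin ι.G.m) :
    ∑ C ∈ cores (ι.family ι.I), (ι.crossedLevels (st C) a b e).card ≤
      2 * b * ι.G.scaledCost e := by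
  classical
  have hK : (ι.coreList ι.baseQuery).toFinset = cores (ι.family ι.I) := by
    ext C; rw [List.mem_toFinset, mem_coreList]
  have hnd := (ι.oracle_spec ι.baseQuery).1
  set L := (legs ι.runs (ι.G.edge e).2).filter fun s => decide (2 * b * s.2.1 < a) with hL
  have hsum : ∀ g : Entry ι.G.n ι.G.m → ℕ, (L.map g).sum = ∑ C ∈ cores (ι.family ι.I),
      ((((st C).filter fun s => decide (s.1 = (ι.G.edge e).2)).filter
        fun s => decide (2 * b * s.2.1 < a)).map g).sum := by
    intro g
    rw [hL, legs_eq hr, List.filter_flatMap, List.map_flatMap, sum_flatMap, ← hK,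
      List.sum_toFinset _ hnd]
  have hbound := fun C (hC : C ∈ cores (ι.family ι.I)) =>
    card_crossedLevels_le (hspec C hC).1 (hspec C hC).2
      (by simpa using hbest _ (single_mem hr hC)) e
  have h1 := (Finset.sum_le_sum fun C hC => (hbound C hC).1).trans (hsum _).ge
  have h2 := (Finset.sum_le_sum fun C hC => (hbound C hC).2).trans (hsum _).ge
  by_cases hlen : L.length ≤ 1
  · refine h2.trans ?_
    rw [List.map_const', List.sum_replicate, smul_eq_mul]
    exact (Nat.mul_le_mul_right _ hlen).trans (one_mul _).le
  · refine h1.trans ?_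
    -- The threshold is the largest distance in `L`.
    obtain ⟨s₀, hs₀, -, hmax⟩ := pick_eq (fun x y : Entry ι.G.n ι.G.m => y.2.1 ≤ x.2.1) L
      (by rintro h; simp [h] at hlen) (fun x _ => le_rfl) (fun x _ y _ => le_total _ _)
      (fun x _ y _ z _ hxy hyz => hyz.trans hxy)
    have hs₀' := List.mem_filter.1 hs₀
    have hQ : (legs ι.runs (ι.G.edge e).2).filter (fun s => decide (s.2.1 ≤ s₀.2.1)) = L := by
      refine List.filter_congr fun s hs => decide_eq_decide.2 ⟨fun h => ?_, fun h => ?_⟩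
      · exact (Nat.mul_le_mul_left _ h).trans_lt (of_decide_eq_true hs₀'.2)
      · exact hmax s (List.mem_filter.2 ⟨hs, decide_eq_true h⟩)
    have hstar := hbest _ (star_mem hs₀'.1 hQ (by omega))
    have hsplit : ∀ l : List (Entry ι.G.n ι.G.m), (∀ s ∈ l, 2 * b * s.2.1 < a) →
        (l.map fun s => a - 2 * b * s.2.1).sum + 2 * b * (l.map fun s => s.2.1).sum =
          l.length * a := by
      intro l hl
      induction l with
      | nil => simp
      | cons s l ih =>
        have h1 := ih fun s' hs' => hl s' (by simp [hs'])
        have h2 := hl s (by simp)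
        simp only [List.map_cons, List.sum_cons, List.length_cons, mul_add, add_mul]
        omega
    have h3 := hsplit L fun s hs => of_decide_eq_true (List.mem_filter.1 hs).2
    dsimp only at hstar
    -- With `q + 2` legs the star has denominator `q + 1 ≥ (q + 2) / 2`; this is the source of the
    -- factor `2`.
    obtain ⟨q, hq⟩ : ∃ q, L.length = q + 2 := ⟨L.length - 2, by omega⟩
    rw [hq] at hstar h3
    have h4 : q + 2 - 1 = q + 1 := by omega
    rw [h4] at hstar
    nlinarith

/-- A ratio that no candidate beats gives a lower bound on the cost of every cover. -/
theorem dual_bound {a b : ℕ} (hb : 1 ≤ b) (hbest : ∀ c ∈ ι.candidates, a * c.2.1 ≤ c.1 * b)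
    {J : Finset (Fin ι.G.m)} (hJ : ι.G.Covers ι.f J) :
    (maxVal ι.f).toNat * a * ι.G.nu ι.f ι.I ≤ 2 * b * ∑ e ∈ J, ι.G.scaledCost e := by
  obtain ⟨st, out, hr, hspec⟩ := ι.exists_runs
  calc (maxVal ι.f).toNat * a * ι.G.nu ι.f ι.I
      = ∑ C ∈ cores (ι.family ι.I), (maxVal ι.f).toNat * a := by
        rw [Finset.sum_const, smul_eq_mul, nu_eq, mul_comm]
    _ ≤ ∑ C ∈ cores (ι.family ι.I), ∑ e ∈ J, (ι.crossedLevels (st C) a b e).card :=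
        Finset.sum_le_sum fun C hC => le_sum_crossedLevels (hspec C hC).1 hJ a hb
    _ = ∑ e ∈ J, ∑ C ∈ cores (ι.family ι.I), (ι.crossedLevels (st C) a b e).card :=
        Finset.sum_comm
    _ ≤ ∑ e ∈ J, 2 * b * ι.G.scaledCost e :=
        Finset.sum_le_sum fun e _ => sum_crossedLevels_le hr hspec hbest e
    _ = _ := by rw [Finset.mul_sum]

/-! ### The returned edge set -/

/-- The comparison of ratios is transitive because the denominators are positive. -/
theorem exists_best (ι : Instance) : ∃ c ∈ ι.candidates, pick CandLe ι.candidates = [c] ∧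
    ∀ x ∈ ι.candidates, CandLe c x := by
  obtain ⟨st, out, hr, -⟩ := ι.exists_runs
  obtain ⟨C, hC⟩ := ι.exists_core
  refine pick_eq CandLe ι.candidates (List.ne_nil_of_mem (single_mem hr hC)) (fun _ _ => le_rfl)
    (fun _ _ _ _ => le_total _ _) fun x hx y hy z hz hxy hyz => ?_
  have h := (candidate_valid hy).1
  unfold CandLe at *
  refine Nat.le_of_mul_le_mul_right (c := y.2.1) ?_ h
  calc x.1 * z.2.1 * y.2.1 = x.1 * y.2.1 * z.2.1 := by ring
    _ ≤ y.1 * x.2.1 * z.2.1 := Nat.mul_le_mul_right _ hxy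
    _ = y.1 * z.2.1 * x.2.1 := by ring
    _ ≤ z.1 * y.2.1 * x.2.1 := Nat.mul_le_mul_right _ hyz
    _ = z.1 * x.2.1 * y.2.1 := by ring

/-- The edge set that the algorithm returns. -/
noncomputable def solution (ι : Instance) : Finset (Fin ι.G.m) := ι.output.toFinset

theorem enc_output (ι : Instance) : enc ι.output = encIndices ι.solution := by
  have hsorted : ι.output.Pairwise (· ≤ ·) := by
    refine List.Pairwise.filter _ ?_
    simp only [Network.arcs, List.map_map]
    exact (List.map_id (List.finRange ι.G.m)).symm ▸ (List.sortedLT_finRange _).pairwise.imp le_of_lt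
  have hnodup : ι.output.Nodup := by
    refine List.Nodup.filter _ ?_
    simp only [Network.arcs, List.map_map]
    exact (List.map_id (List.finRange ι.G.m)).symm ▸ List.nodup_finRange _
  rw [encIndices, solution, (List.toFinset_sort (· ≤ ·) hnodup).2 hsorted]
  rfl

/-- Scaling multiplies all costs by the same number, the product of the denominators. -/
theorem scaledCost_eq (G : Network) (e : Fin G.m) :
    (G.scaledCost e : ℚ) = (∏ e', (G.cost e').den : ℕ) * (G.cost e : ℚ) := by
  have h1 : G.scaledCost e = (G.cost e).num * ∏ e' ∈ Finset.univ.erase e, (G.cost e').den := by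
    rw [Network.scaledCost, ← Finset.mul_prod_erase _ _ (Finset.mem_univ e), if_pos rfl]
    congr 1
    exact Finset.prod_congr rfl fun e' he' => if_neg (Finset.ne_of_mem_erase he')
  have h2 : (∏ e', (G.cost e').den) = (G.cost e).den * ∏ e' ∈ Finset.univ.erase e,
      (G.cost e').den := (Finset.mul_prod_erase _ _ (Finset.mem_univ e)).symm
  have h3 : ((G.cost e).num : ℚ) = (G.cost e).den * (G.cost e : ℚ) := by
    have := NNRat.den_mul_eq_num (G.cost e)
    exact_mod_cast this.symm
  rw [h1, h2]
  push_cast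
  rw [h3]; ring

theorem sum_scaledCost_eq (G : Network) (S : Finset (Fin G.m)) :
    ((∑ e ∈ S, G.scaledCost e : ℕ) : ℚ) = (∏ e', (G.cost e').den : ℕ) * (G.totalCost S : ℚ) := by
  rw [Network.totalCost, Nat.cast_sum]
  push_cast
  rw [Finset.mul_sum]
  refine Finset.sum_congr rfl fun e _ => ?_
  rw [scaledCost_eq]; push_cast; ring

theorem solution_spec (ι : Instance) {J : Finset (Fin ι.G.m)} (hJ : ι.G.Covers ι.f J) :
    Disjoint ι.solution ι.I ∧ ι.G.nu ι.f (ι.I ∪ ι.solution) < ι.G.nu ι.f ι.I ∧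
    (ι.G.totalCost ι.solution : ℚ) /
        ((ι.G.nu ι.f ι.I : ℚ) - (ι.G.nu ι.f (ι.I ∪ ι.solution) : ℚ)) ≤
      2 / (maxVal ι.f : ℚ) * ((ι.G.totalCost J : ℚ) / (ι.G.nu ι.f ι.I : ℚ)) := by
  classical
  obtain ⟨c, hc, hpick, hbest⟩ := ι.exists_best
  have hmem : ∀ e, e ∈ ι.solution ↔ e ∉ ι.I ∧ e ∈ c.2.2 := by
    intro e
    simp [solution, output, hpick, Network.arcs]
  obtain ⟨hb, hcost, hred⟩ := candidate_valid hc
  have hnu := hred (ι.I ∪ ι.solution) Finset.subset_union_left fun e he => by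
    by_cases heI : e ∈ ι.I
    · simp [heI]
    · simp [hmem, heI, he]
  have hcost' : ∑ e ∈ ι.solution, ι.G.scaledCost e ≤ c.1 :=
    (sum_le_sum_list _ c.2.2 _ fun e he => ((hmem e).1 he).2).trans hcost
  have hdual := dual_bound hb hbest hJ
  refine ⟨Finset.disjoint_left.2 fun e he => ((hmem e).1 he).1, by omega, ?_⟩
  set D : ℕ := ∏ e', (ι.G.cost e').den with hD
  have hDpos : (0 : ℚ) < D := by
    have : 0 < D := Finset.prod_pos fun e _ => (ι.G.cost e).den_pos
    exact_mod_cast this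
  have hk : ((maxVal ι.f).toNat : ℚ) = (maxVal ι.f : ℚ) := by
    have : ((maxVal ι.f).toNat : ℤ) = maxVal ι.f := Int.toNat_of_nonneg ι.pos.le
    exact_mod_cast this
  have hkpos : (0 : ℚ) < (maxVal ι.f : ℚ) := by exact_mod_cast ι.pos
  have hnupos : (0 : ℚ) < ι.G.nu ι.f ι.I := by exact_mod_cast ι.nu_pos
  have hbpos : (0 : ℚ) < c.2.1 := by exact_mod_cast hb
  have h1 : (D : ℚ) * ι.G.totalCost ι.solution ≤ c.1 := by
    rw [← sum_scaledCost_eq]; exact_mod_cast hcost'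
  have h2 : (maxVal ι.f : ℚ) * c.1 * ι.G.nu ι.f ι.I ≤
      2 * c.2.1 * (D * ι.G.totalCost J) := by
    rw [← sum_scaledCost_eq, ← hk]; exact_mod_cast hdual
  have h3 : (c.2.1 : ℚ) ≤ (ι.G.nu ι.f ι.I : ℚ) - (ι.G.nu ι.f (ι.I ∪ ι.solution) : ℚ) := by
    rw [le_sub_iff_add_le']; exact_mod_cast hnu
  have h4 : (0 : ℚ) ≤ ι.G.totalCost ι.solution := NNRat.coe_nonneg _
  calc _ ≤ (ι.G.totalCost ι.solution : ℚ) / c.2.1 := by gcongr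
    _ ≤ _ := by
      rw [div_mul_div_comm, div_le_div_iff₀ hbpos (mul_pos hkpos hnupos)]
      refine le_of_mul_le_mul_left ?_ hDpos
      calc (D : ℚ) * (ι.G.totalCost ι.solution * (maxVal ι.f * ι.G.nu ι.f ι.I))
          = D * ι.G.totalCost ι.solution * (maxVal ι.f * ι.G.nu ι.f ι.I) := by ring
        _ ≤ c.1 * (maxVal ι.f * ι.G.nu ι.f ι.I) := by gcongr
        _ = maxVal ι.f * c.1 * ι.G.nu ι.f ι.I := by ring
        _ ≤ _ := h2
        _ = _ := by ring

end Instance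

end EdgeCover

open EdgeCover Machine in
theorem mainTheorem3 :
    ∃ (p : Prog) (P : Polynomial ℕ),
      ∀ (G : Network) (f : Finset (Fin G.n) → ℤ) (O : Data → Data) (τ : ℚ≥0),
        PosIntersectingSupermodular G.T f →
        (∀ A : Finset (Fin G.n), 0 < f A → (A ∩ G.T).Nonempty) →
        0 < maxVal f →
        G.QuasiBipartite f →
        G.IsOptimalValue f τ →
        IsCoreOracle f O →
        ∀ I : Finset (Fin G.m), 1 ≤ G.nu f I →
          ∃ (S : Finset (Fin G.m)) (t : ℕ),
            Run O p (encInput G I) (encIndices S) t ∧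
            t ≤ P.eval (encInput G I).size ∧
            Disjoint S I ∧
            G.nu f (I ∪ S) < G.nu f I ∧
            (G.totalCost S : ℚ) / ((G.nu f I : ℚ) - (G.nu f (I ∪ S) : ℚ)) ≤
              2 / (maxVal f : ℚ) * ((τ : ℚ) / (G.nu f I : ℚ)) := by
  obtain ⟨p, P, h⟩ := exists_prog
  refine ⟨p, P, fun G f O τ hf hT hpos hqb hτ hO I hI => ?_⟩
  obtain ⟨J, hJ, rfl⟩ := hτ.1
  let ι : Instance := ⟨G, f, O, I, hf, hT, hpos, hqb, ⟨J, hJ⟩, hO, hI⟩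
  obtain ⟨t, hrun, ht⟩ := h ι
  rw [ι.enc_output] at hrun
  exact ⟨ι.solution, t, hrun, ht, ι.solution_spec hJ⟩
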